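/- Conventions. An $f$-algebra is a real vector lattice $A$ with an associative bilinear product (not assumed unital) such that products of positive elements are positive, and $a\wedge b=0$, $c\ge 0$ imply $(ca)\wedge b=(ac)\wedge b=0$. A normed $f$-algebra is an $f$-algebra with a norm satisfying $|a|\le |b|\Rightarrow \|a\|\le\|b\|$ and $\|ab\|\le\|a\|\,\|b\|$; a Banach $f$-algebra is a complete normed $f$-algebra. A lattice-algebra homomorphism is a linear map preserving $\vee$, $\wedge$ and products. Construction. Let $E$ be a real normed space with topological dual $E^*$. For $x\in E$ let $\delta_x\in\mathbb R^{E^*}$ be $\delta_x(\omega)=\omega(x)$, and let $\mathrm{FAFA}[E]$ be the sublattice-algebra of $\mathbb R^{E^*}$ (pointwise operations) generated by $\{\delta_x: x\in E\}$. Let $\mathcal N$ be the set of seminorms $\nu$ on $\mathrm{FAFA}[E]$ such that $|f|\le|g|\Rightarrow\nu(f)\le\nu(g)$, $\nu(fg)\le\nu(f)\nu(g)$ and $\nu(\delta_x)\le\|x\|$ for all $x\in E$, and let $\rho=\sup_{\nu\in\mathcal N}\nu$ pointwise (the supremum is finite). Let $\mathrm{FNFA}[E]=\mathrm{FAFA}[E]/\ker\rho$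 with the quotient operations and order and the norm induced by $\rho$, let $q$ be the quotient map and $\eta_E(x)=q(\delta_x)$. Let $\mathrm{FBFA}[E]$ be the norm completion of $\mathrm{FNFA}[E]$, with the operations extended by continuity, and denote also by $\eta_E$ the composition of $\eta_E$ with the canonical embedding $\mathrm{FNFA}[E]\to\mathrm{FBFA}[E]$. Then $\mathrm{FNFA}[E]$ is a normed $f$-algebra and $\mathrm{FBFA}[E]$ is a Banach $f$-algebra. Proposition. Let $E$ be a real normed space. (1) $\rho$ is the greatest element of $\mathcal N$; $q$ is a surjective lattice-algebra homomorphism with $\|q(f)\|=\rho(f)$ for all $f$; and the canonical embedding $\mathrm{FNFA}[E]\to\mathrm{FBFA}[E]$ is a lattice-algebra homomorphism with dense range. (2) $\mathrm{FNFA}[E]$ together with $\eta_E$ is the free normed $f$-algebra generated by $E$: $\eta_E$ is a linear isometric embedding, and for every normed $f$-algebra $A$ and every linear operator $T\colon E\to A$ with $\|T\|\le 1$ there is a unique lattice-algebra homomorphism $\hat T\colon\mathrm{FNFA}[E]\to A$ with $\hat T\circ\eta_E=T$; moreover, $\hat T$ is bounded and $\|\hat T\|=\|T\|$. (3) If $E$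 is a Banach space, then $\mathrm{FBFA}[E]$ together with $\eta_E$ is the free Banach $f$-algebra generated by $E$: $\eta_E$ is a linear isometric embedding, and for every Banach $f$-algebra $A$ and every linear operator $T\colon E\to A$ with $\|T\|\le 1$ there is a unique lattice-algebra homomorphism $\hat T\colon\mathrm{FBFA}[E]\to A$ with $\hat T\circ\eta_E=T$; moreover, $\hat T$ is bounded and $\|\hat T\|=\|T\|$. -/

import Mathlib

open UniformSpace Topology

noncomputable section

/-- A real `f`-algebra (associative, not assumed unital or commutative): a vector lattice with an
associative bilinear product such that products of positive elements are positive and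
`a ⊓ b = 0`, `0 ≤ c` imply `(c * a) ⊓ b = 0 = (a * c) ⊓ b`. -/
class IsFAlgebra (A : Type*) [NonUnitalRing A] [Module ℝ A] [Lattice A] : Prop
    extends IsOrderedAddMonoid A, PosSMulMono ℝ A, IsScalarTower ℝ A A, SMulCommClass ℝ A A where
  mul_nonneg_of_nonneg : ∀ a b : A, 0 ≤ a → 0 ≤ b → 0 ≤ a * b
  mul_left_inf_eq_zero : ∀ a b c : A, a ⊓ b = 0 → 0 ≤ c → (c * a) ⊓ b = 0
  mul_right_inf_eq_zero : ∀ a b c : A, a ⊓ b = 0 → 0 ≤ c → (a * c) ⊓ b = 0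

/-- Lattice-algebra homomorphisms: linear maps preserving products, suprema and infima. -/
structure IsLatticeAlgHom {A B : Type*} [NonUnitalRing A] [Module ℝ A] [Lattice A]
    [NonUnitalRing B] [Module ℝ B] [Lattice B] (φ : A →ₗ[ℝ] B) : Prop where
  map_mul : ∀ a b : A, φ (a * b) = φ a * φ b
  map_sup : ∀ a b : A, φ (a ⊔ b) = φ a ⊔ φ b
  map_inf : ∀ a b : A, φ (a ⊓ b) = φ a ⊓ φ b

/-- `F`, together with `η : E → F`, is the free normed `f`-algebra generated by the normed
space `E`. A normed `f`-algebra is an `f`-algebra with a submultiplicative lattice norm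
(`NonUnitalNormedRing`, `NormedSpace ℝ`, `Lattice`, `IsFAlgebra`, `HasSolidNorm`). -/
structure IsFreeNormedFAlgebra.{u, v, w} (E : Type u) [NormedAddCommGroup E] [NormedSpace ℝ E]
    (F : Type v) [NonUnitalNormedRing F] [NormedSpace ℝ F] [Lattice F] [IsFAlgebra F]
    [HasSolidNorm F] (η : E →ₗ[ℝ] F) : Prop where
  isometry : ∀ x : E, ‖η x‖ = ‖x‖
  lift : ∀ (A : Type w) [NonUnitalNormedRing A] [NormedSpace ℝ A] [Lattice A] [IsFAlgebra A]
    [HasSolidNorm A] (T : E →L[ℝ] A), ‖T‖ ≤ 1 →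
    ∃ T' : F →L[ℝ] A, IsLatticeAlgHom (T' : F →ₗ[ℝ] A) ∧ (∀ x : E, T' (η x) = T x) ∧
      ‖T'‖ = ‖T‖ ∧
      ∀ S : F →ₗ[ℝ] A, IsLatticeAlgHom S → (∀ x : E, S (η x) = T x) → S = (T' : F →ₗ[ℝ] A)

/-- `F`, together with `η : E → F`, is the free Banach `f`-algebra generated by the Banach
space `E`. A Banach `f`-algebra is a complete normed `f`-algebra. -/
structure IsFreeBanachFAlgebra.{u, v, w} (E : Type u) [NormedAddCommGroup E] [NormedSpace ℝ E]
    (F : Type v) [NonUnitalNormedRing F] [NormedSpace ℝ F] [Lattice F] [IsFAlgebra F]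
    [HasSolidNorm F] [CompleteSpace F] (η : E →ₗ[ℝ] F) : Prop where
  isometry : ∀ x : E, ‖η x‖ = ‖x‖
  lift : ∀ (A : Type w) [NonUnitalNormedRing A] [NormedSpace ℝ A] [Lattice A] [IsFAlgebra A]
    [HasSolidNorm A] [CompleteSpace A] (T : E →L[ℝ] A), ‖T‖ ≤ 1 →
    ∃ T' : F →L[ℝ] A, IsLatticeAlgHom (T' : F →ₗ[ℝ] A) ∧ (∀ x : E, T' (η x) = T x) ∧
      ‖T'‖ = ‖T‖ ∧
      ∀ S : F →ₗ[ℝ] A, IsLatticeAlgHom S → (∀ x : E, S (η x) = T x) → S = (T' : F →ₗ[ℝ] A)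

/-! ### Equational form of the axioms, used to pass to quotients and completions -/

theorem IsFAlgebra.of_eqns {B : Type*} [NonUnitalRing B] [Module ℝ B] [Lattice B]
    (hadd : ∀ a b c : B, a + c ≤ (a ⊔ b) + c)
    (hsmul : ∀ r : ℝ, 0 ≤ r → ∀ a b : B, r • a ≤ r • (a ⊔ b))
    (htower : ∀ (r : ℝ) (a b : B), (r • a) * b = r • (a * b))
    (hcomm : ∀ (r : ℝ) (a b : B), a * (r • b) = r • (a * b))
    (hmul : ∀ a b : B, 0 ≤ |a| * |b|)
    (hl : ∀ a b c : B, (|c| * (a - a ⊓ b)) ⊓ (b - a ⊓ b) = 0)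
    (hr : ∀ a b c : B, ((a - a ⊓ b) * |c|) ⊓ (b - a ⊓ b) = 0) : IsFAlgebra B := by
  have : IsOrderedAddMonoid B := ⟨fun a b h c => by
    simpa [sup_eq_right.2 h] using hadd a b c, fun a b h c => by
    simpa [sup_eq_right.2 h, add_comm] using hadd a b c⟩
  have : PosSMulMono ℝ B := ⟨fun r hr' a b h => by
    simpa [sup_eq_right.2 h] using hsmul r hr' a b⟩
  have : IsScalarTower ℝ B B := ⟨fun r a b => by simpa using htower r a b⟩
  have : SMulCommClass ℝ B B := ⟨fun r a b => by simpa using (hcomm r a b).symm⟩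
  exact
    { mul_nonneg_of_nonneg := fun a b ha hb => by
        simpa [abs_of_nonneg ha, abs_of_nonneg hb] using hmul a b
      mul_left_inf_eq_zero := fun a b c h hc => by
        simpa [abs_of_nonneg hc, h] using hl a b c
      mul_right_inf_eq_zero := fun a b c h hc => by
        simpa [abs_of_nonneg hc, h] using hr a b c }

section eqns
variable {A : Type*} [NonUnitalRing A] [Module ℝ A] [Lattice A] [IsFAlgebra A]

theorem IsFAlgebra.eqn_disj (a b : A) : (a - a ⊓ b) ⊓ (b - a ⊓ b) = 0 := by
  rw [← inf_sub, sub_self]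

theorem IsFAlgebra.eqn_left (a b c : A) : (|c| * (a - a ⊓ b)) ⊓ (b - a ⊓ b) = 0 :=
  IsFAlgebra.mul_left_inf_eq_zero _ _ _ (IsFAlgebra.eqn_disj a b) (abs_nonneg c)

theorem IsFAlgebra.eqn_right (a b c : A) : ((a - a ⊓ b) * |c|) ⊓ (b - a ⊓ b) = 0 :=
  IsFAlgebra.mul_right_inf_eq_zero _ _ _ (IsFAlgebra.eqn_disj a b) (abs_nonneg c)

end eqns

/-! ### The sublattice-algebra generated by a set of functions -/

/-- The sublattice-algebra of `ℝ^X` (pointwise operations) generated by `S`. -/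
def vectorLatticeAlgebraSpan {X : Type*} (S : Set (X → ℝ)) : NonUnitalSubalgebra ℝ (X → ℝ) :=
  sInf {B | S ⊆ B ∧ SupClosed (B : Set (X → ℝ)) ∧ InfClosed (B : Set (X → ℝ))}

section span
variable {X : Type*} {S : Set (X → ℝ)}

theorem mem_vectorLatticeAlgebraSpan {f : X → ℝ} : f ∈ vectorLatticeAlgebraSpan S ↔
    ∀ B : NonUnitalSubalgebra ℝ (X → ℝ), S ⊆ B → SupClosed (B : Set (X → ℝ)) →
      InfClosed (B : Set (X → ℝ)) → f ∈ B := by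
  simp [vectorLatticeAlgebraSpan, NonUnitalAlgebra.mem_sInf]

theorem subset_vectorLatticeAlgebraSpan {f : X → ℝ} (hf : f ∈ S) :
    f ∈ vectorLatticeAlgebraSpan S :=
  mem_vectorLatticeAlgebraSpan.2 fun _ h _ _ => h hf

theorem sup_mem_vectorLatticeAlgebraSpan ⦃f g : X → ℝ⦄ (hf : f ∈ vectorLatticeAlgebraSpan S)
    (hg : g ∈ vectorLatticeAlgebraSpan S) : f ⊔ g ∈ vectorLatticeAlgebraSpan S :=
  mem_vectorLatticeAlgebraSpan.2 fun B h h1 h2 =>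
    h1 (mem_vectorLatticeAlgebraSpan.1 hf B h h1 h2) (mem_vectorLatticeAlgebraSpan.1 hg B h h1 h2)

theorem inf_mem_vectorLatticeAlgebraSpan ⦃f g : X → ℝ⦄ (hf : f ∈ vectorLatticeAlgebraSpan S)
    (hg : g ∈ vectorLatticeAlgebraSpan S) : f ⊓ g ∈ vectorLatticeAlgebraSpan S :=
  mem_vectorLatticeAlgebraSpan.2 fun B h h1 h2 =>
    h2 (mem_vectorLatticeAlgebraSpan.1 hf B h h1 h2) (mem_vectorLatticeAlgebraSpan.1 hg B h h1 h2)

end span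

/-! ### The free Archimedean `f`-algebra `FAFA E` -/

section fafa
variable (E : Type*) [NormedAddCommGroup E] [NormedSpace ℝ E]

/-- `FAFA E` is the sublattice-algebra of `ℝ^{E*}` generated by the evaluations
`δ_x : ω ↦ ω x`, `x ∈ E`, where `E*` is the topological dual of `E`. -/
def FAFA : Type _ :=
  ↥(vectorLatticeAlgebraSpan (Set.range fun (x : E) (ω : StrongDual ℝ E) => ω x))

namespace FAFA

instance : NonUnitalCommRing (FAFA E) := inferInstanceAs (NonUnitalCommRing
  ↥(vectorLatticeAlgebraSpan (Set.range fun (x : E) (ω : StrongDual ℝ E) => ω x)))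

instance : Module ℝ (FAFA E) := inferInstanceAs (Module ℝ
  ↥(vectorLatticeAlgebraSpan (Set.range fun (x : E) (ω : StrongDual ℝ E) => ω x)))

instance : Lattice (FAFA E) :=
  Subtype.lattice sup_mem_vectorLatticeAlgebraSpan inf_mem_vectorLatticeAlgebraSpan

variable {E}

/-- An element of `FAFA E` as a function on `E*`. -/
def val (f : FAFA E) : StrongDual ℝ E → ℝ := Subtype.val f

theorem val_injective : Function.Injective (val : FAFA E → _) := Subtype.val_injective

theorem le_iff {f g : FAFA E} : f ≤ g ↔ ∀ ω, f.val ω ≤ g.val ω := Iff.rfl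
@[simp] theorem val_zero (ω : StrongDual ℝ E) : (0 : FAFA E).val ω = 0 := rfl
@[simp] theorem val_add (f g : FAFA E) (ω : StrongDual ℝ E) :
    (f + g).val ω = f.val ω + g.val ω := rfl
@[simp] theorem val_mul (f g : FAFA E) (ω : StrongDual ℝ E) :
    (f * g).val ω = f.val ω * g.val ω := rfl
@[simp] theorem val_smul (r : ℝ) (f : FAFA E) (ω : StrongDual ℝ E) :
    (r • f).val ω = r * f.val ω := rfl
@[simp] theorem val_sup (f g : FAFA E) (ω : StrongDual ℝ E) :
    (f ⊔ g).val ω = f.val ω ⊔ g.val ω := rfl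
@[simp] theorem val_inf (f g : FAFA E) (ω : StrongDual ℝ E) :
    (f ⊓ g).val ω = f.val ω ⊓ g.val ω := rfl

theorem ext_val {f g : FAFA E} (h : ∀ ω, f.val ω = g.val ω) : f = g := val_injective (funext h)

theorem real_inf_mul {a b c : ℝ} (h : a ⊓ b = 0) (hc : 0 ≤ c) : (c * a) ⊓ b = 0 := by
  have ha : 0 ≤ a := h ▸ inf_le_left
  have hb : 0 ≤ b := h ▸ inf_le_right
  rcases min_choice a b with h' | h'
  · have : a = 0 := h'.symm.trans h
    simp [this, hb]
  · have : b = 0 := h'.symm.trans h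
    simp [this, mul_nonneg hc ha]

instance : IsFAlgebra (FAFA E) where
  add_le_add_left := fun f g h k => le_iff.2 fun ω => by simpa using le_iff.1 h ω
  smul_le_smul_of_nonneg_left := fun r hr f g h => le_iff.2 fun ω => by
    simpa using mul_le_mul_of_nonneg_left (le_iff.1 h ω) hr
  smul_assoc := fun r f g => ext_val fun ω => by simp [mul_assoc]
  smul_comm := fun r f g => ext_val fun ω => by simp [mul_left_comm]
  mul_nonneg_of_nonneg := fun f g hf hg => le_iff.2 fun ω => by
    simpa using mul_nonneg (le_iff.1 hf ω) (le_iff.1 hg ω)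
  mul_left_inf_eq_zero := fun f g k h hk => ext_val fun ω => by
    have h1 : (f ⊓ g).val ω = 0 := by rw [h]; rfl
    simpa using real_inf_mul (by simpa using h1) (le_iff.1 hk ω)
  mul_right_inf_eq_zero := fun f g k h hk => ext_val fun ω => by
    have h1 : (f ⊓ g).val ω = 0 := by rw [h]; rfl
    simpa [mul_comm] using real_inf_mul (by simpa using h1) (le_iff.1 hk ω)

/-- The canonical linear map `δ : E → FAFA E`, `δ x = (ω ↦ ω x)`. -/
def δ : E →ₗ[ℝ] FAFA E where
  toFun x := ⟨fun ω => ω x, subset_vectorLatticeAlgebraSpan ⟨x, rfl⟩⟩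
  map_add' x y := ext_val fun ω => ω.map_add x y
  map_smul' r x := ext_val fun ω => ω.map_smul r x

/-- Induction over the generation of `FAFA E`. -/
theorem induction {p : FAFA E → Prop} (hδ : ∀ x : E, p (δ x)) (h0 : p 0)
    (hadd : ∀ f g, p f → p g → p (f + g)) (hsmul : ∀ (r : ℝ) f, p f → p (r • f))
    (hmul : ∀ f g, p f → p g → p (f * g)) (hsup : ∀ f g, p f → p g → p (f ⊔ g))
    (hinf : ∀ f g, p f → p g → p (f ⊓ g)) (f : FAFA E) : p f := by
  let B : NonUnitalSubalgebra ℝ (StrongDual ℝ E → ℝ) :=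
    { carrier := {f | ∃ g : FAFA E, g.val = f ∧ p g}
      add_mem' := by
        rintro _ _ ⟨f, rfl, hf⟩ ⟨g, rfl, hg⟩
        exact ⟨f + g, rfl, hadd f g hf hg⟩
      zero_mem' := ⟨0, rfl, h0⟩
      mul_mem' := by
        rintro _ _ ⟨f, rfl, hf⟩ ⟨g, rfl, hg⟩
        exact ⟨f * g, rfl, hmul f g hf hg⟩
      smul_mem' := by
        rintro r _ ⟨f, rfl, hf⟩
        exact ⟨r • f, rfl, hsmul r f hf⟩ }
  obtain ⟨g, hg, hp⟩ : f.val ∈ B := by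
    refine mem_vectorLatticeAlgebraSpan.1 f.2 B ?_ ?_ ?_
    · rintro _ ⟨x, rfl⟩
      exact ⟨δ x, rfl, hδ x⟩
    · rintro _ ⟨f, rfl, hf⟩ _ ⟨g, rfl, hg⟩
      exact ⟨f ⊔ g, rfl, hsup f g hf hg⟩
    · rintro _ ⟨f, rfl, hf⟩ _ ⟨g, rfl, hg⟩
      exact ⟨f ⊓ g, rfl, hinf f g hf hg⟩
  exact val_injective hg ▸ hp

/-! ### The greatest admissible seminorm -/

/-- Admissible seminorms: submultiplicative lattice seminorms `ν` with `ν (δ x) ≤ ‖x‖`. -/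
structure IsAdmissible (ν : Seminorm ℝ (FAFA E)) : Prop where
  solid : ∀ f g : FAFA E, |f| ≤ |g| → ν f ≤ ν g
  mul_le : ∀ f g : FAFA E, ν (f * g) ≤ ν f * ν g
  le_norm : ∀ x : E, ν (δ x) ≤ ‖x‖

theorem IsAdmissible.sup_le {ν : Seminorm ℝ (FAFA E)} (h : IsAdmissible ν) (f g : FAFA E) :
    ν (f ⊔ g) ≤ ν f + ν g := by
  have e : ∀ k : FAFA E, ν |k| = ν k := fun k =>
    le_antisymm (h.solid _ _ (abs_abs k).le) (h.solid _ _ (abs_abs k).ge)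
  have h1 : |f ⊔ g| ≤ |(|f| + |g|)| := by
    rw [abs_of_nonneg (add_nonneg (abs_nonneg f) (abs_nonneg g))]
    refine abs_le'.2 ⟨_root_.sup_le ?_ ?_, ?_⟩
    · exact (le_abs_self f).trans (le_add_of_nonneg_right (abs_nonneg g))
    · exact (le_abs_self g).trans (le_add_of_nonneg_left (abs_nonneg f))
    · exact ((neg_le_neg le_sup_left).trans (neg_le_abs f)).trans
        (le_add_of_nonneg_right (abs_nonneg g))
  calc ν (f ⊔ g) ≤ ν (|f| + |g|) := h.solid _ _ h1
    _ ≤ ν |f| + ν |g| := map_add_le_add ν _ _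
    _ = ν f + ν g := by rw [e, e]

theorem exists_bound (f : FAFA E) :
    ∃ C : ℝ, 0 ≤ C ∧ ∀ ν : Seminorm ℝ (FAFA E), IsAdmissible ν → ν f ≤ C := by
  have hsup : ∀ f g : FAFA E,
      (∃ C : ℝ, 0 ≤ C ∧ ∀ ν : Seminorm ℝ (FAFA E), IsAdmissible ν → ν f ≤ C) →
      (∃ C : ℝ, 0 ≤ C ∧ ∀ ν : Seminorm ℝ (FAFA E), IsAdmissible ν → ν g ≤ C) →
      ∃ C : ℝ, 0 ≤ C ∧ ∀ ν : Seminorm ℝ (FAFA E), IsAdmissible ν → ν (f ⊔ g) ≤ C := by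
    rintro f g ⟨C, hC, h⟩ ⟨D, hD, h'⟩
    exact ⟨C + D, by positivity, fun ν hν =>
      (hν.sup_le f g).trans (add_le_add (h ν hν) (h' ν hν))⟩
  refine induction (fun x => ⟨‖x‖, norm_nonneg x, fun ν hν => hν.le_norm x⟩)
    ⟨0, le_rfl, fun ν _ => (map_zero ν).le⟩ ?_ ?_ ?_ hsup ?_ f
  · rintro f g ⟨C, hC, h⟩ ⟨D, hD, h'⟩
    exact ⟨C + D, by positivity, fun ν hν =>
      (map_add_le_add ν f g).trans (add_le_add (h ν hν) (h' ν hν))⟩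
  · rintro r f ⟨C, hC, h⟩
    exact ⟨‖r‖ * C, by positivity, fun ν hν => by
      rw [map_smul_eq_mul]
      exact mul_le_mul_of_nonneg_left (h ν hν) (norm_nonneg r)⟩
  · rintro f g ⟨C, hC, h⟩ ⟨D, hD, h'⟩
    exact ⟨C * D, by positivity, fun ν hν =>
      (hν.mul_le f g).trans (mul_le_mul (h ν hν) (h' ν hν) (apply_nonneg ν g) hC)⟩
  · rintro f g ⟨C, hC, h⟩ ⟨D, hD, h'⟩
    obtain ⟨K, hK, h''⟩ := hsup (-f) (-g) ⟨C, hC, fun ν hν => by simpa using h ν hν⟩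
      ⟨D, hD, fun ν hν => by simpa using h' ν hν⟩
    refine ⟨K, hK, fun ν hν => ?_⟩
    have := h'' ν hν
    rwa [← neg_inf, map_neg_eq_map] at this

variable (E) in
theorem isAdmissible_zero : IsAdmissible (0 : Seminorm ℝ (FAFA E)) where
  solid := fun _ _ _ => le_rfl
  mul_le := fun _ _ => by simp
  le_norm := fun x => by simp

instance : Nonempty {ν : Seminorm ℝ (FAFA E) // IsAdmissible ν} := ⟨⟨0, isAdmissible_zero E⟩⟩

theorem bddAbove_range (f : FAFA E) :
    BddAbove (Set.range fun ν : {ν : Seminorm ℝ (FAFA E) // IsAdmissible ν} => ν.1 f) := by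
  obtain ⟨C, -, hC⟩ := exists_bound f
  exact ⟨C, by rintro _ ⟨ν, rfl⟩; exact hC ν.1 ν.2⟩

theorem le_iSup_admissible {ν : Seminorm ℝ (FAFA E)} (hν : IsAdmissible ν) (f : FAFA E) :
    ν f ≤ ⨆ ν : {ν : Seminorm ℝ (FAFA E) // IsAdmissible ν}, ν.1 f :=
  le_ciSup (bddAbove_range f) (⟨ν, hν⟩ : {ν : Seminorm ℝ (FAFA E) // IsAdmissible ν})

variable (E) in
/-- `ρ f` is the supremum of `ν f` over all admissible seminorms `ν` (a bounded supremum, by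
`bddAbove_range`). -/
def ρ : Seminorm ℝ (FAFA E) :=
  Seminorm.of (fun f => ⨆ ν : {ν : Seminorm ℝ (FAFA E) // IsAdmissible ν}, ν.1 f)
    (fun f g => ciSup_le fun ν => (map_add_le_add ν.1 f g).trans
      (add_le_add (le_iSup_admissible ν.2 f) (le_iSup_admissible ν.2 g)))
    (fun r f => by
      rw [Real.mul_iSup_of_nonneg (norm_nonneg r)]
      exact iSup_congr fun ν => map_smul_eq_mul ν.1 r f)

theorem ρ_apply (f : FAFA E) :
    ρ E f = ⨆ ν : {ν : Seminorm ℝ (FAFA E) // IsAdmissible ν}, ν.1 f := rfl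

theorem isAdmissible_ρ : IsAdmissible (ρ E) where
  solid := fun f g h => ciSup_le fun ν => (ν.2.solid f g h).trans (le_iSup_admissible ν.2 g)
  mul_le := fun f g => ciSup_le fun ν => (ν.2.mul_le f g).trans
    (mul_le_mul (le_iSup_admissible ν.2 f) (le_iSup_admissible ν.2 g) (apply_nonneg ν.1 g)
      (apply_nonneg (ρ E) f))
  le_norm := fun x => ciSup_le fun ν => ν.2.le_norm x

/-- `FAFA E` is regarded as a seminormed algebra with the seminorm `ρ`. -/
instance : NonUnitalSeminormedRing (FAFA E) :=
  { (ρ E).toAddGroupSeminorm.toSeminormedAddGroup,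
    (inferInstance : NonUnitalRing (FAFA E)) with
    norm_mul_le := isAdmissible_ρ.mul_le }

theorem norm_eq (f : FAFA E) : ‖f‖ = ρ E f := rfl

instance : NormedSpace ℝ (FAFA E) where
  norm_smul_le := fun r f => (map_smul_eq_mul (ρ E) r f).le

theorem norm_solid {f g : FAFA E} (h : |f| ≤ |g|) : ‖f‖ ≤ ‖g‖ := isAdmissible_ρ.solid f g h

theorem inseparable_iff {f g : FAFA E} : Inseparable f g ↔ ρ E (f - g) = 0 := by
  rw [Metric.inseparable_iff, dist_eq_norm, norm_eq]

theorem inseparable_of_abs_le {f g f' g' h h' : FAFA E} (hf : Inseparable f f')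
    (hg : Inseparable g g') (hh : |h - h'| ≤ |f - f'| + |g - g'|) : Inseparable h h' := by
  rw [inseparable_iff] at *
  have e : ∀ k : FAFA E, ρ E |k| = ρ E k := fun k =>
    le_antisymm (isAdmissible_ρ.solid _ _ (abs_abs k).le)
      (isAdmissible_ρ.solid _ _ (abs_abs k).ge)
  refine le_antisymm ?_ (apply_nonneg _ _)
  calc ρ E (h - h') ≤ ρ E (|f - f'| + |g - g'|) := isAdmissible_ρ.solid _ _ (by
        rwa [abs_of_nonneg (add_nonneg (abs_nonneg (f - f')) (abs_nonneg (g - g')))])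
    _ ≤ ρ E |f - f'| + ρ E |g - g'| := map_add_le_add _ _ _
    _ = 0 := by rw [e, e, hf, hg, add_zero]

end FAFA

/-! ### The free normed `f`-algebra `FNFA E` -/

/-- `FNFA E` is the quotient of `FAFA E` by the kernel of `ρ`: in the separation quotient two
elements `f`, `g` are identified if and only if `ρ (f - g) = 0`. -/
def FNFA : Type _ := SeparationQuotient (FAFA E)

namespace FNFA

instance : NonUnitalNormedRing (FNFA E) :=
  inferInstanceAs (NonUnitalNormedRing (SeparationQuotient (FAFA E)))

instance : NormedSpace ℝ (FNFA E) :=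
  inferInstanceAs (NormedSpace ℝ (SeparationQuotient (FAFA E)))

/-- The quotient map `FAFA E → FNFA E`. -/
def q : FAFA E →ₗ[ℝ] FNFA E where
  toFun f := (SeparationQuotient.mk f : SeparationQuotient (FAFA E))
  map_add' _ _ := rfl
  map_smul' _ _ := rfl

variable {E}

theorem q_surjective : Function.Surjective (q E) := SeparationQuotient.surjective_mk

theorem q_eq_iff {f g : FAFA E} : q E f = q E g ↔ FAFA.ρ E (f - g) = 0 :=
  SeparationQuotient.mk_eq_mk.trans FAFA.inseparable_iff

theorem norm_q (f : FAFA E) : ‖q E f‖ = FAFA.ρ E f := SeparationQuotient.norm_mk f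

theorem q_mul (f g : FAFA E) : q E (f * g) = q E f * q E g := rfl

/-- The supremum in `FNFA E`, induced by that of `FAFA E`. -/
def sup : FNFA E → FNFA E → FNFA E :=
  SeparationQuotient.lift₂ (fun f g => q E (f ⊔ g)) fun f g f' g' hf hg =>
    SeparationQuotient.mk_eq_mk.2 <| FAFA.inseparable_of_abs_le hf hg <| by
      calc |f ⊔ g - f' ⊔ g'| = |f ⊔ g - f' ⊔ g + (f' ⊔ g - f' ⊔ g')| := by
            rw [sub_add_sub_cancel]
        _ ≤ |f ⊔ g - f' ⊔ g| + |f' ⊔ g - f' ⊔ g'| := abs_add_le _ _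
        _ ≤ |f - f'| + |g - g'| := by
          gcongr ?_ + ?_
          · exact abs_sup_sub_sup_le_abs _ _ _
          · rw [sup_comm f', sup_comm f']
            exact abs_sup_sub_sup_le_abs _ _ _

/-- The infimum in `FNFA E`, induced by that of `FAFA E`. -/
def inf : FNFA E → FNFA E → FNFA E :=
  SeparationQuotient.lift₂ (fun f g => q E (f ⊓ g)) fun f g f' g' hf hg =>
    SeparationQuotient.mk_eq_mk.2 <| FAFA.inseparable_of_abs_le hf hg <| by
      calc |f ⊓ g - f' ⊓ g'| = |f ⊓ g - f' ⊓ g + (f' ⊓ g - f' ⊓ g')| := by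
            rw [sub_add_sub_cancel]
        _ ≤ |f ⊓ g - f' ⊓ g| + |f' ⊓ g - f' ⊓ g'| := abs_add_le _ _
        _ ≤ |f - f'| + |g - g'| := by
          gcongr ?_ + ?_
          · exact abs_inf_sub_inf_le_abs _ _ _
          · rw [inf_comm f', inf_comm f']
            exact abs_inf_sub_inf_le_abs _ _ _

/-- The quotient lattice structure: `q f ⊔ q g = q (f ⊔ g)`, `q f ⊓ q g = q (f ⊓ g)`, and
`a ≤ b` means `a ⊔ b = b`. -/
instance : Lattice (FNFA E) := by
  refine @Lattice.mk' _ ⟨sup⟩ ⟨inf⟩ ?_ ?_ ?_ ?_ ?_ ?_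
  · intro a b
    obtain ⟨f, rfl⟩ := q_surjective a
    obtain ⟨g, rfl⟩ := q_surjective b
    exact congrArg (q E) (sup_comm f g)
  · intro a b c
    obtain ⟨f, rfl⟩ := q_surjective a
    obtain ⟨g, rfl⟩ := q_surjective b
    obtain ⟨h, rfl⟩ := q_surjective c
    exact congrArg (q E) (sup_assoc f g h)
  · intro a b
    obtain ⟨f, rfl⟩ := q_surjective a
    obtain ⟨g, rfl⟩ := q_surjective b
    exact congrArg (q E) (inf_comm f g)
  · intro a b c
    obtain ⟨f, rfl⟩ := q_surjective a
    obtain ⟨g, rfl⟩ := q_surjective b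
    obtain ⟨h, rfl⟩ := q_surjective c
    exact congrArg (q E) (inf_assoc f g h)
  · intro a b
    obtain ⟨f, rfl⟩ := q_surjective a
    obtain ⟨g, rfl⟩ := q_surjective b
    exact congrArg (q E) (sup_inf_self (a := f) (b := g))
  · intro a b
    obtain ⟨f, rfl⟩ := q_surjective a
    obtain ⟨g, rfl⟩ := q_surjective b
    exact congrArg (q E) (inf_sup_self (a := f) (b := g))

theorem q_sup (f g : FAFA E) : q E (f ⊔ g) = q E f ⊔ q E g := rfl
theorem q_inf (f g : FAFA E) : q E (f ⊓ g) = q E f ⊓ q E g := rfl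
theorem q_abs (f : FAFA E) : q E |f| = |q E f| := rfl

theorem q_mono {f g : FAFA E} (h : f ≤ g) : q E f ≤ q E g := by
  rw [← sup_eq_right, ← q_sup, sup_eq_right.2 h]

instance : IsFAlgebra (FNFA E) := by
  refine IsFAlgebra.of_eqns ?_ ?_ ?_ ?_ ?_ ?_ ?_
  · intro a b c
    obtain ⟨f, rfl⟩ := q_surjective a
    obtain ⟨g, rfl⟩ := q_surjective b
    obtain ⟨h, rfl⟩ := q_surjective c
    exact q_mono (add_le_add_left (le_sup_left : f ≤ f ⊔ g) h)
  · intro r hr a b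
    obtain ⟨f, rfl⟩ := q_surjective a
    obtain ⟨g, rfl⟩ := q_surjective b
    exact q_mono (smul_le_smul_of_nonneg_left (le_sup_left : f ≤ f ⊔ g) hr)
  · intro r a b
    obtain ⟨f, rfl⟩ := q_surjective a
    obtain ⟨g, rfl⟩ := q_surjective b
    exact congrArg (q E) (smul_mul_assoc r f g)
  · intro r a b
    obtain ⟨f, rfl⟩ := q_surjective a
    obtain ⟨g, rfl⟩ := q_surjective b
    exact congrArg (q E) (mul_smul_comm r f g)
  · intro a b
    obtain ⟨f, rfl⟩ := q_surjective a
    obtain ⟨g, rfl⟩ := q_surjective b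
    exact q_mono (IsFAlgebra.mul_nonneg_of_nonneg _ _ (abs_nonneg f) (abs_nonneg g))
  · intro a b c
    obtain ⟨f, rfl⟩ := q_surjective a
    obtain ⟨g, rfl⟩ := q_surjective b
    obtain ⟨h, rfl⟩ := q_surjective c
    exact congrArg (q E) (IsFAlgebra.eqn_left f g h)
  · intro a b c
    obtain ⟨f, rfl⟩ := q_surjective a
    obtain ⟨g, rfl⟩ := q_surjective b
    obtain ⟨h, rfl⟩ := q_surjective c
    exact congrArg (q E) (IsFAlgebra.eqn_right f g h)

instance : HasSolidNorm (FNFA E) where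
  solid := by
    intro a b hab
    obtain ⟨f, rfl⟩ := q_surjective a
    obtain ⟨g, rfl⟩ := q_surjective b
    have h1 : ‖q E f‖ = ‖q E (|f| ⊓ |g|)‖ := by
      rw [q_inf, q_abs, q_abs, inf_eq_left.2 hab, ← q_abs, norm_q, norm_q]
      exact le_antisymm (FAFA.isAdmissible_ρ.solid _ _ (abs_abs f).ge)
        (FAFA.isAdmissible_ρ.solid _ _ (abs_abs f).le)
    rw [h1, norm_q, norm_q]
    refine FAFA.isAdmissible_ρ.solid _ _ ?_
    rw [abs_of_nonneg (le_inf (abs_nonneg f) (abs_nonneg g))]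
    exact inf_le_right

variable (E) in
/-- The canonical map `η_E = q ∘ δ : E → FNFA E`. -/
def η : E →ₗ[ℝ] FNFA E := q E ∘ₗ FAFA.δ

end FNFA

/-! ### The free Banach `f`-algebra `FBFA E` -/

/-- `FBFA E` is the norm completion of `FNFA E`. -/
def FBFA : Type _ := Completion (FNFA E)

namespace FBFA

instance : NormedAddCommGroup (FBFA E) :=
  inferInstanceAs (NormedAddCommGroup (Completion (FNFA E)))

instance : NormedSpace ℝ (FBFA E) := inferInstanceAs (NormedSpace ℝ (Completion (FNFA E)))

instance : CompleteSpace (FBFA E) := inferInstanceAs (CompleteSpace (Completion (FNFA E)))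

/-- The canonical embedding of `FNFA E` into its completion. -/
def ι : FNFA E →ₗᵢ[ℝ] FBFA E :=
  (Completion.toComplₗᵢ : FNFA E →ₗᵢ[ℝ] Completion (FNFA E))

variable {E}

theorem isDenseInducing_ι : IsDenseInducing (ι E) := Completion.isDenseInducing_coe

theorem continuous_ι : Continuous (ι E) := (ι E).continuous

/-- The product of `FBFA E`: the continuous extension of the product of `FNFA E`. -/
def mul (x y : FBFA E) : FBFA E :=
  (isDenseInducing_ι.prodMap isDenseInducing_ι).extend
    (fun p : FNFA E × FNFA E => ι E (p.1 * p.2)) (x, y)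

theorem continuous_mul' : Continuous fun p : FBFA E × FBFA E => mul p.1 p.2 := by
  let e : FNFA E →+ FBFA E := (ι E).toLinearMap.toAddMonoidHom
  have de : IsDenseInducing e := isDenseInducing_ι
  let m : FNFA E →+ FNFA E →+ FBFA E := (AddMonoidHom.mul : FNFA E →+ FNFA E →+ FNFA E).compr₂ e
  have hm : Continuous fun p : FNFA E × FNFA E => m p.1 p.2 :=
    continuous_ι.comp (continuous_fst.mul continuous_snd)
  exact de.extend_Z_bilin de hm

theorem mul_ι (a b : FNFA E) : mul (ι E a) (ι E b) = ι E (a * b) :=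
  (isDenseInducing_ι.prodMap isDenseInducing_ι).extend_eq
    (f := fun p : FNFA E × FNFA E => ι E (p.1 * p.2))
    (continuous_ι.comp (continuous_fst.mul continuous_snd)) (a, b)

theorem ind {p : FBFA E → Prop} (x : FBFA E) (hp : IsClosed {x | p x})
    (h : ∀ a, p (ι E a)) : p x :=
  Completion.induction_on x hp h

theorem ind₂ {p : FBFA E → FBFA E → Prop} (x y : FBFA E)
    (hp : IsClosed {x : FBFA E × FBFA E | p x.1 x.2}) (h : ∀ a b, p (ι E a) (ι E b)) : p x y :=
  Completion.induction_on₂ x y hp h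

theorem ind₃ {p : FBFA E → FBFA E → FBFA E → Prop} (x y z : FBFA E)
    (hp : IsClosed {x : FBFA E × FBFA E × FBFA E | p x.1 x.2.1 x.2.2})
    (h : ∀ a b c, p (ι E a) (ι E b) (ι E c)) : p x y z :=
  Completion.induction_on₃ x y z hp h

instance : Mul (FBFA E) := ⟨mul⟩

instance : ContinuousMul (FBFA E) := ⟨continuous_mul'⟩

theorem ι_mul (a b : FNFA E) : ι E (a * b) = ι E a * ι E b := (mul_ι a b).symm

theorem mul_add' (x y z : FBFA E) : x * (y + z) = x * y + x * z :=
  ind₃ (p := fun x y z => x * (y + z) = x * y + x * z) x y z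
    (isClosed_eq (by fun_prop) (by fun_prop)) fun a b c => by
      simp only [← ι_mul, ← map_add, mul_add]

theorem add_mul' (x y z : FBFA E) : (x + y) * z = x * z + y * z :=
  ind₃ (p := fun x y z => (x + y) * z = x * z + y * z) x y z
    (isClosed_eq (by fun_prop) (by fun_prop)) fun a b c => by
      simp only [← ι_mul, ← map_add, add_mul]

instance : NonUnitalNormedRing (FBFA E) where
  __ := (inferInstance : NormedAddCommGroup (FBFA E))
  __ := (inferInstance : Mul (FBFA E))
  left_distrib := mul_add'
  right_distrib := add_mul'
  zero_mul x := by
    have := add_mul' 0 0 x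
    rw [add_zero] at this
    exact left_eq_add.1 this
  mul_zero x := by
    have := mul_add' x 0 0
    rw [add_zero] at this
    exact left_eq_add.1 this
  mul_assoc x y z :=
    ind₃ (p := fun x y z => x * y * z = x * (y * z)) x y z
      (isClosed_eq (by fun_prop) (by fun_prop)) fun a b c => by
        simp only [← ι_mul, mul_assoc]
  norm_mul_le x y :=
    ind₂ (p := fun x y => ‖x * y‖ ≤ ‖x‖ * ‖y‖) x y
      (isClosed_le (by fun_prop) (by fun_prop)) fun a b => by
        simpa only [← ι_mul, LinearIsometry.norm_map] using norm_mul_le a b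

/-- The supremum of `FBFA E`: the continuous extension of that of `FNFA E`. -/
def sup : FBFA E → FBFA E → FBFA E :=
  Completion.map₂ (fun a b : FNFA E => a ⊔ b)

/-- The infimum of `FBFA E`: the continuous extension of that of `FNFA E`. -/
def inf : FBFA E → FBFA E → FBFA E :=
  Completion.map₂ (fun a b : FNFA E => a ⊓ b)

theorem uniformContinuous_sup : UniformContinuous₂ fun a b : FNFA E => a ⊔ b := by
  refine Metric.uniformContinuous_iff.2 fun ε hε => ⟨ε / 2, half_pos hε, fun {p q} h => ?_⟩
  have h1 := norm_sup_sub_sup_le_add_norm p.1 p.2 q.1 q.2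
  have h2 : dist p.1 q.1 < ε / 2 := (le_max_left _ _).trans_lt h
  have h3 : dist p.2 q.2 < ε / 2 := (le_max_right _ _).trans_lt h
  rw [dist_eq_norm] at h2 h3
  change dist (p.1 ⊔ p.2) (q.1 ⊔ q.2) < ε
  rw [dist_eq_norm]
  linarith

theorem uniformContinuous_inf : UniformContinuous₂ fun a b : FNFA E => a ⊓ b := by
  refine Metric.uniformContinuous_iff.2 fun ε hε => ⟨ε / 2, half_pos hε, fun {p q} h => ?_⟩
  have h1 := norm_inf_sub_inf_le_add_norm p.1 p.2 q.1 q.2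
  have h2 : dist p.1 q.1 < ε / 2 := (le_max_left _ _).trans_lt h
  have h3 : dist p.2 q.2 < ε / 2 := (le_max_right _ _).trans_lt h
  rw [dist_eq_norm] at h2 h3
  change dist (p.1 ⊓ p.2) (q.1 ⊓ q.2) < ε
  rw [dist_eq_norm]
  linarith

theorem sup_ι (a b : FNFA E) : sup (ι E a) (ι E b) = ι E (a ⊔ b) :=
  Completion.map₂_coe_coe a b _ uniformContinuous_sup

theorem inf_ι (a b : FNFA E) : inf (ι E a) (ι E b) = ι E (a ⊓ b) :=
  Completion.map₂_coe_coe a b _ uniformContinuous_inf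

@[fun_prop]
theorem continuous_sup' {Z : Type*} [TopologicalSpace Z] {f g : Z → FBFA E} (hf : Continuous f)
    (hg : Continuous g) : Continuous fun z => sup (f z) (g z) :=
  Completion.continuous_map₂ hf hg

@[fun_prop]
theorem continuous_inf' {Z : Type*} [TopologicalSpace Z] {f g : Z → FBFA E} (hf : Continuous f)
    (hg : Continuous g) : Continuous fun z => inf (f z) (g z) :=
  Completion.continuous_map₂ hf hg

/-- The lattice structure extended from `FNFA E`; `x ≤ y` means `x ⊔ y = y`. -/
instance : Lattice (FBFA E) := by
  refine @Lattice.mk' _ ⟨sup⟩ ⟨inf⟩ ?_ ?_ ?_ ?_ ?_ ?_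
  · exact fun x y => ind₂ (p := fun x y => sup x y = sup y x) x y
      (isClosed_eq (by fun_prop) (by fun_prop)) fun a b => by simp only [sup_ι, sup_comm]
  · exact fun x y z => ind₃ (p := fun x y z => sup (sup x y) z = sup x (sup y z)) x y z
      (isClosed_eq (by fun_prop) (by fun_prop)) fun a b c => by simp only [sup_ι, sup_assoc]
  · exact fun x y => ind₂ (p := fun x y => inf x y = inf y x) x y
      (isClosed_eq (by fun_prop) (by fun_prop)) fun a b => by simp only [inf_ι, inf_comm]
  · exact fun x y z => ind₃ (p := fun x y z => inf (inf x y) z = inf x (inf y z)) x y z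
      (isClosed_eq (by fun_prop) (by fun_prop)) fun a b c => by simp only [inf_ι, inf_assoc]
  · exact fun x y => ind₂ (p := fun x y => sup x (inf x y) = x) x y
      (isClosed_eq (by fun_prop) (by fun_prop)) fun a b => by
        simp only [inf_ι, sup_ι, sup_inf_self]
  · exact fun x y => ind₂ (p := fun x y => inf x (sup x y) = x) x y
      (isClosed_eq (by fun_prop) (by fun_prop)) fun a b => by
        simp only [inf_ι, sup_ι, inf_sup_self]

instance : ContinuousSup (FBFA E) := ⟨continuous_sup' continuous_fst continuous_snd⟩

instance : ContinuousInf (FBFA E) := ⟨continuous_inf' continuous_fst continuous_snd⟩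

theorem ι_sup (a b : FNFA E) : ι E (a ⊔ b) = ι E a ⊔ ι E b := (sup_ι a b).symm
theorem ι_inf (a b : FNFA E) : ι E (a ⊓ b) = ι E a ⊓ ι E b := (inf_ι a b).symm

theorem ι_abs (a : FNFA E) : ι E |a| = |ι E a| := by
  change ι E (a ⊔ -a) = ι E a ⊔ -ι E a
  rw [ι_sup, map_neg]

theorem ι_mono {a b : FNFA E} (h : a ≤ b) : ι E a ≤ ι E b := by
  rw [← sup_eq_right, ← ι_sup, sup_eq_right.2 h]

theorem isClosed_le' {Z : Type*} [TopologicalSpace Z] {f g : Z → FBFA E} (hf : Continuous f)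
    (hg : Continuous g) : IsClosed {z | f z ≤ g z} := by
  simp only [← sup_eq_right]
  exact isClosed_eq (hf.sup hg) hg

theorem continuous_abs' : Continuous fun x : FBFA E => |x| :=
  continuous_id.sup continuous_neg

instance : IsFAlgebra (FBFA E) := by
  have habs : Continuous fun x : FBFA E => |x| := continuous_abs'
  refine IsFAlgebra.of_eqns ?_ ?_ ?_ ?_ ?_ ?_ ?_
  · exact fun x y z => ind₃ (p := fun x y z => x + z ≤ (x ⊔ y) + z) x y z
      (isClosed_le' (by fun_prop) (by fun_prop)) fun a b c => by
        simp only [← ι_sup, ← map_add]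
        exact ι_mono (add_le_add_left le_sup_left c)
  · exact fun r hr x y => ind₂ (p := fun x y => r • x ≤ r • (x ⊔ y)) x y
      (isClosed_le' (continuous_fst.const_smul r) ((continuous_fst.sup continuous_snd).const_smul r))
      fun a b => by
        simp only [← ι_sup, ← map_smul]
        exact ι_mono (smul_le_smul_of_nonneg_left le_sup_left hr)
  · exact fun r x y => ind₂ (p := fun x y => (r • x) * y = r • (x * y)) x y
      (isClosed_eq ((continuous_fst.const_smul r).mul continuous_snd)
        ((continuous_fst.mul continuous_snd).const_smul r)) fun a b => by
        simp only [← ι_mul, ← map_smul, smul_mul_assoc]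
  · exact fun r x y => ind₂ (p := fun x y => x * (r • y) = r • (x * y)) x y
      (isClosed_eq (continuous_fst.mul (continuous_snd.const_smul r))
        ((continuous_fst.mul continuous_snd).const_smul r)) fun a b => by
        simp only [← ι_mul, ← map_smul, mul_smul_comm]
  · exact fun x y => ind₂ (p := fun x y => 0 ≤ |x| * |y|) x y
      (isClosed_le' (by fun_prop) (by fun_prop)) fun a b => by
        rw [← ι_abs, ← ι_abs, ← ι_mul, ← map_zero (ι E)]
        exact ι_mono (IsFAlgebra.mul_nonneg_of_nonneg _ _ (abs_nonneg a) (abs_nonneg b))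
  · exact fun x y z => ind₃ (p := fun x y z => (|z| * (x - x ⊓ y)) ⊓ (y - x ⊓ y) = 0) x y z
      (isClosed_eq (by fun_prop) (by fun_prop)) fun a b c => by
        simp only [← ι_abs, ← ι_inf, ← ι_mul, ← map_sub, IsFAlgebra.eqn_left, map_zero]
  · exact fun x y z => ind₃ (p := fun x y z => ((x - x ⊓ y) * |z|) ⊓ (y - x ⊓ y) = 0) x y z
      (isClosed_eq (by fun_prop) (by fun_prop)) fun a b c => by
        simp only [← ι_abs, ← ι_inf, ← ι_mul, ← map_sub, IsFAlgebra.eqn_right, map_zero]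

instance : HasSolidNorm (FBFA E) where
  solid := by
    have habs : Continuous fun x : FBFA E => |x| := continuous_abs'
    have h1 : ∀ x : FBFA E, ‖|x|‖ = ‖x‖ := fun x => ind (p := fun x => ‖|x|‖ = ‖x‖) x
      (isClosed_eq (by fun_prop) (by fun_prop)) fun a => by
        rw [← ι_abs, LinearIsometry.norm_map, LinearIsometry.norm_map, norm_abs_eq_norm]
    have h2 : ∀ x y : FBFA E, ‖|x| ⊓ |y|‖ ≤ ‖y‖ := fun x y =>
      ind₂ (p := fun x y => ‖|x| ⊓ |y|‖ ≤ ‖y‖) x y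
        (isClosed_le (by fun_prop) (by fun_prop)) fun a b => by
          rw [← ι_abs, ← ι_abs, ← ι_inf, LinearIsometry.norm_map, LinearIsometry.norm_map]
          refine norm_le_norm_of_abs_le_abs ?_
          rw [abs_of_nonneg (le_inf (abs_nonneg a) (abs_nonneg b))]
          exact inf_le_right
    intro x y h
    have := h2 x y
    rwa [inf_eq_left.2 h, h1] at this

variable (E) in
/-- The canonical map `E → FBFA E`: the composition of `η_E` with the embedding of `FNFA E`
into its completion. -/
def η : E →ₗ[ℝ] FBFA E := (ι E).toLinearMap ∘ₗ FNFA.η E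

end FBFA
end fafa

end

universe u w

noncomputable section

/-! ### Disjointness in vector lattices -/

section disjoint
variable {A : Type*} [AddCommGroup A] [Lattice A] [IsOrderedAddMonoid A]

/-! Every element of `FAFA E` is the value of a lattice-algebra term at the evaluations `δ x`, so a
linear `T : E → A` extends to `FAFA E` as soon as every term that vanishes at all functionals of `E`
also vanishes at `T` in `A`. This is `LatticeAlgTerm.eval_eq_zero`, the heart of the proof.

Suppose the value `z` of such a term at `T` is nonzero, and let `e` be the sum of the `|T x|` over
its variables. In a normed `f`-algebra, multiplication by `a` is dominated by `r` times the identity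
for every `r > ‖a‖` (`map_le_smul_of_inf_eq_zero`). So all values stay in the order ideal generated
by `e`, and every order ideal is a ring ideal. A Zorn argument on total preorders
(`exists_maximal_ideal`) yields an order ideal `M` that misses `|z|` and modulo which the ideal of
`e` is the line `ℝ e`. The induced product on that line is `w * (x * y)` with `e * e ≡ w e` and `0 ≤
w`. On the finite-dimensional span of the variables `T` becomes a functional, which extends to some
`ω` in the dual by Hahn–Banach. If `w > 0`, rescaling turns the weighted product into the usual one;
`w = 0` is a limit case. Hence `z ∈ M`, a contradiction.

The norm estimates come from the maximality of `ρ`: for `0 < ‖T‖ ≤ 1` the seminorm `f ↦ ‖T‖⁻¹ *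
‖lift T f‖` is admissible, hence at most `ρ`. So the extension factors through `FNFA E` with norm at
most `‖T‖`, and then extends to the completion. Uniqueness on `FBFA E` is claimed among all
homomorphisms, not only bounded ones; it holds because positive operators on a Banach lattice are
automatically continuous. -/

theorem le_of_le_add_of_inf_eq_zero {x y w : A} (hy : 0 ≤ y) (h : x ≤ y + w) (hd : x ⊓ w = 0) :
    x ≤ y := by
  calc x ≤ (y + x) ⊓ (y + w) := le_inf (le_add_of_nonneg_left hy) h
    _ = y := by rw [← add_inf, hd, add_zero]

theorem add_inf_eq_zero_of_inf_eq_zero {x y w : A} (hx : x ⊓ w = 0) (hy : y ⊓ w = 0) :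
    (x + y) ⊓ w = 0 := by
  have hx0 : 0 ≤ x := hx ▸ inf_le_left
  have hw0 : 0 ≤ w := hx ▸ inf_le_right
  have hy0 : 0 ≤ y := hy ▸ inf_le_left
  have h0 : 0 ≤ (x + y) ⊓ w := le_inf (add_nonneg hx0 hy0) hw0
  have h1 : (x + y) ⊓ w ≤ x := le_of_le_add_of_inf_eq_zero hx0 inf_le_left
    (le_antisymm (hy ▸ le_inf inf_le_right (inf_le_left.trans inf_le_right)) (le_inf h0 hy0))
  exact le_antisymm (hx ▸ le_inf h1 inf_le_right) h0

theorem smul_inf_eq_zero_of_inf_eq_zero [Module ℝ A] [PosSMulMono ℝ A] {x w : A} {r : ℝ}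
    (hr : 0 ≤ r) (h : x ⊓ w = 0) : (r • x) ⊓ w = 0 := by
  have hx0 : 0 ≤ x := h ▸ inf_le_left
  have hw0 : 0 ≤ w := h ▸ inf_le_right
  obtain ⟨n, hn⟩ := exists_nat_ge r
  have hn' : ∀ n : ℕ, (n • x) ⊓ w = 0 := by
    intro n
    induction n with
    | zero => simpa using hw0
    | succ k ih => rw [succ_nsmul]; exact add_inf_eq_zero_of_inf_eq_zero ih h
  have h1 : r • x ≤ n • x := by
    rw [← Nat.cast_smul_eq_nsmul ℝ, ← sub_nonneg, ← sub_smul]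
    exact smul_nonneg (sub_nonneg.2 hn) hx0
  exact le_antisymm ((inf_le_inf_right w h1).trans (hn' n).le) (le_inf (smul_nonneg hr hx0) hw0)

end disjoint

/-! ### Bounded orthomorphisms of normed vector lattices -/

/-- On the part of the space where `L b` exceeds `r • b`, iteration makes `L^n b` grow at least like
`r ^ n`, whereas its norm is at most `s ^ n * ‖b‖`. With `e` the positive part of `L b - r • b`,
this forces `b ⊓ e = 0`, and disjointness then gives `e = 0`. -/
theorem map_le_smul_of_inf_eq_zero {A : Type*} [NormedAddCommGroup A] [NormedSpace ℝ A] [Lattice A]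
    [IsOrderedAddMonoid A] [PosSMulMono ℝ A] [HasSolidNorm A] (L : A →ₗ[ℝ] A)
    (hpos : ∀ x, 0 ≤ x → 0 ≤ L x) (hdisj : ∀ x y, x ⊓ y = 0 → L x ⊓ y = 0) {r s : ℝ}
    (hs : 0 ≤ s) (hsr : s < r) (hL : ∀ x, ‖L x‖ ≤ s * ‖x‖) {b : A} (hb : 0 ≤ b) :
    L b ≤ r • b := by
  have hr : 0 < r := hs.trans_lt hsr
  have hmono : ∀ x y, x ≤ y → L x ≤ L y := fun x y h => by
    rw [← sub_nonneg, ← map_sub]; exact hpos _ (sub_nonneg.2 h)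
  set e := (L b - r • b)⁺ with he
  set w := (L b - r • b)⁻
  have hwe : w ⊓ e = 0 := by rw [inf_comm]; exact posPart_inf_negPart_eq_zero _
  have hLn : ∀ n : ℕ, 0 ≤ L^[n] b ∧ ‖L^[n] b‖ ≤ s ^ n * ‖b‖ := by
    intro n
    induction n with
    | zero => simpa using hb
    | succ k ih =>
      rw [Function.iterate_succ_apply']
      refine ⟨hpos _ ih.1, (hL _).trans ?_⟩
      rw [pow_succ', mul_assoc]
      exact mul_le_mul_of_nonneg_left ih.2 hs
  -- The error `v` remains disjoint from `e`: each iteration applies `L`, which preserves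
  -- disjointness from `e`, and adds a multiple of the negative part `w`.
  have key : ∀ n : ℕ, ∃ v, v ⊓ e = 0 ∧ r ^ n • b ≤ L^[n] b + v := by
    intro n
    induction n with
    | zero => exact ⟨0, by simp [he, posPart_nonneg], by simp⟩
    | succ k ih =>
      obtain ⟨v, hv, h⟩ := ih
      refine ⟨L v + r ^ k • w, add_inf_eq_zero_of_inf_eq_zero (hdisj _ _ hv)
        (smul_inf_eq_zero_of_inf_eq_zero (by positivity) hwe), ?_⟩
      have h1 : r • b ≤ L b + w := by
        have : L b - r • b = e - w := (posPart_sub_negPart _).symm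
        have h2 : L b + w - r • b = e := by
          rw [add_sub_right_comm, this, sub_add_cancel]
        rw [← sub_nonneg, h2]; exact posPart_nonneg _
      have h2 := smul_le_smul_of_nonneg_left h1 (pow_nonneg hr.le k)
      have h3 := hmono _ _ h
      rw [map_smul, map_add] at h3
      rw [Function.iterate_succ_apply', pow_succ, mul_smul]
      refine h2.trans ?_
      rw [smul_add, ← add_assoc]
      exact add_le_add_left h3 _
  have hbe0 : 0 ≤ b ⊓ e := le_inf hb (posPart_nonneg _)
  have hle : ∀ n : ℕ, r ^ n * ‖b ⊓ e‖ ≤ s ^ n * ‖b‖ := by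
    intro n
    obtain ⟨v, hv, h⟩ := key n
    have h1 : r ^ n • (b ⊓ e) ≤ L^[n] b := by
      refine le_of_le_add_of_inf_eq_zero (hLn n).1
        ((smul_le_smul_of_nonneg_left inf_le_left (pow_nonneg hr.le n)).trans h) ?_
      refine smul_inf_eq_zero_of_inf_eq_zero (pow_nonneg hr.le n) ?_
      rw [inf_assoc, inf_comm e v, hv]
      exact inf_eq_right.2 hb
    have h2 : ‖r ^ n • (b ⊓ e)‖ ≤ ‖L^[n] b‖ := norm_le_norm_of_abs_le_abs <| by
      rwa [abs_of_nonneg (hLn n).1, abs_of_nonneg (smul_nonneg (pow_nonneg hr.le n) hbe0)]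
    rw [norm_smul, Real.norm_of_nonneg (pow_nonneg hr.le n)] at h2
    exact h2.trans (hLn n).2
  have hz : b ⊓ e = 0 := by
    have ht : Filter.Tendsto (fun n : ℕ => (s / r) ^ n * ‖b‖) Filter.atTop (𝓝 (0 * ‖b‖)) :=
      (tendsto_pow_atTop_nhds_zero_of_lt_one (by positivity) ((div_lt_one hr).2 hsr)).mul_const _
    rw [zero_mul] at ht
    refine norm_le_zero_iff.1 (ge_of_tendsto' ht fun n => ?_)
    rw [div_pow, div_mul_eq_mul_div, le_div_iff₀ (by positivity), mul_comm]
    exact hle n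
  -- Disjointness of `b` and `e` passes to `L b` and `e`, but `e ≤ L b`; so `e` is disjoint from
  -- itself.
  have h1 : e ≤ L b := sup_le (sub_le_self _ (smul_nonneg hr.le hb)) (hpos b hb)
  have h2 : e = 0 := by
    have := hdisj _ _ hz
    rwa [inf_eq_right.2 h1] at this
  exact sub_nonpos.1 (posPart_eq_zero.1 h2)

/-! ### Multiplication operators as bounded orthomorphisms -/

namespace IsFAlgebra

theorem abs_mul_le {A : Type*} [NonUnitalRing A] [Module ℝ A] [Lattice A] [IsFAlgebra A]
    (a b : A) : |a * b| ≤ |a| * |b| := by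
  have hp : ∀ x y : A, 0 ≤ x⁺ * y⁺ ∧ 0 ≤ x⁺ * y⁻ ∧ 0 ≤ x⁻ * y⁺ ∧ 0 ≤ x⁻ * y⁻ := fun x y =>
    ⟨mul_nonneg_of_nonneg _ _ (posPart_nonneg _) (posPart_nonneg _),
      mul_nonneg_of_nonneg _ _ (posPart_nonneg _) (negPart_nonneg _),
      mul_nonneg_of_nonneg _ _ (negPart_nonneg _) (posPart_nonneg _),
      mul_nonneg_of_nonneg _ _ (negPart_nonneg _) (negPart_nonneg _)⟩
  obtain ⟨h1, h2, h3, h4⟩ := hp a b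
  rw [← posPart_add_negPart a, ← posPart_add_negPart b]
  nth_rw 1 [← posPart_sub_negPart a, ← posPart_sub_negPart b]
  -- The two differences `|a| * |b| ∓ a * b` are twice the sum of the mixed products `a⁺ * b⁻ + a⁻ *
  -- b⁺`, respectively of the like ones `a⁺ * b⁺ + a⁻ * b⁻`.
  refine abs_le'.2 ⟨?_, ?_⟩ <;> rw [← sub_nonneg]
  · refine (add_nonneg (add_nonneg h2 h3) (add_nonneg h2 h3)).trans_eq ?_
    noncomm_ring
  · refine (add_nonneg (add_nonneg h1 h4) (add_nonneg h1 h4)).trans_eq ?_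
    noncomm_ring

section normed
variable {A : Type*} [NonUnitalNormedRing A] [NormedSpace ℝ A] [Lattice A] [IsFAlgebra A]
    [HasSolidNorm A]

theorem abs_mul_le_smul_right {a : A} {r : ℝ} (hr : ‖a‖ < r) (b : A) : |a * b| ≤ r • |b| := by
  refine (abs_mul_le a b).trans ?_
  refine map_le_smul_of_inf_eq_zero (LinearMap.mulLeft ℝ |a|) ?_ ?_ (norm_nonneg a) hr ?_
    (abs_nonneg b)
  · exact fun x hx => mul_nonneg_of_nonneg _ _ (abs_nonneg a) hx
  · exact fun x y h => mul_left_inf_eq_zero _ _ _ h (abs_nonneg a)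
  · exact fun x => (norm_mul_le _ _).trans_eq (by rw [norm_abs_eq_norm])

theorem abs_mul_le_smul_left {b : A} {r : ℝ} (hr : ‖b‖ < r) (a : A) : |a * b| ≤ r • |a| := by
  refine (abs_mul_le a b).trans ?_
  refine map_le_smul_of_inf_eq_zero (LinearMap.mulRight ℝ |b|) ?_ ?_ (norm_nonneg b) hr ?_
    (abs_nonneg a)
  · exact fun x hx => mul_nonneg_of_nonneg _ _ hx (abs_nonneg b)
  · exact fun x y h => mul_right_inf_eq_zero _ _ _ h (abs_nonneg b)
  · exact fun x => (norm_mul_le _ _).trans_eq (by rw [norm_abs_eq_norm, mul_comm])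

end normed
end IsFAlgebra

/-! ### Total preorders of lattice-ordered groups -/

/-- `J` is the set of elements that are `≤ 0` for a translation-invariant lattice preorder
coarser than the order of `A`. -/
structure IsNegCone {A : Type*} [AddCommGroup A] [Lattice A] (J : Set A) : Prop where
  zero : 0 ∈ J
  lower : ∀ x y, x ≤ y → y ∈ J → x ∈ J
  add : ∀ x y, x ∈ J → y ∈ J → x + y ∈ J
  pos : ∀ x, x ∈ J → x⁺ ∈ J

namespace IsNegCone
variable {A : Type*} [AddCommGroup A] [Lattice A]

theorem nsmul {J : Set A} (h : IsNegCone J) {x : A} (hx : x ∈ J) (n : ℕ) : n • x ∈ J := by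
  induction n with
  | zero => simpa using h.zero
  | succ k ih => rw [succ_nsmul]; exact h.add _ _ ih hx

theorem subset_adjoin {J : Set A} (h : IsNegCone J) (x : A) :
    J ⊆ {y | ∃ j ∈ J, 0 ≤ j ∧ ∃ n : ℕ, y ≤ j + n • x⁺} :=
  fun y hy => ⟨y⁺, h.pos y hy, posPart_nonneg y, 0, by simpa using le_posPart y⟩

theorem mem_adjoin {J : Set A} (h : IsNegCone J) (x : A) :
    x ∈ {y | ∃ j ∈ J, 0 ≤ j ∧ ∃ n : ℕ, y ≤ j + n • x⁺} :=
  ⟨0, h.zero, le_rfl, 1, by simpa using le_posPart x⟩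

variable [IsOrderedAddMonoid A]

theorem smul [Module ℝ A] [PosSMulMono ℝ A] {J : Set A} (h : IsNegCone J) {x : A} (hx : x ∈ J)
    {r : ℝ} (hr : 0 ≤ r) : r • x ∈ J := by
  obtain ⟨n, hn⟩ := exists_nat_ge r
  refine h.lower _ (n • x⁺) ?_ (h.nsmul (h.pos x hx) n)
  refine (smul_le_smul_of_nonneg_left (le_posPart x) hr).trans ?_
  rw [← Nat.cast_smul_eq_nsmul ℝ, ← sub_nonneg, ← sub_smul]
  exact smul_nonneg (sub_nonneg.2 hn) (posPart_nonneg x)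

theorem sup {J : Set A} (h : IsNegCone J) {x y : A} (hx : x ∈ J) (hy : y ∈ J) :
    x ⊔ y ∈ J :=
  h.lower _ _ (sup_le ((le_posPart x).trans (le_add_of_nonneg_right (posPart_nonneg y)))
    ((le_posPart y).trans (le_add_of_nonneg_left (posPart_nonneg x))))
    (h.add _ _ (h.pos x hx) (h.pos y hy))

/-- The negative cone generated by `J` and `x`. -/
theorem adjoin {J : Set A} (h : IsNegCone J) (x : A) :
    IsNegCone {y | ∃ j ∈ J, 0 ≤ j ∧ ∃ n : ℕ, y ≤ j + n • x⁺} where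
  zero := ⟨0, h.zero, le_rfl, 0, by simp⟩
  lower := fun y z hyz ⟨j, hj, hj0, n, hn⟩ => ⟨j, hj, hj0, n, hyz.trans hn⟩
  add := fun y z ⟨j, hj, hj0, n, hn⟩ ⟨k, hk, hk0, m, hm⟩ =>
    ⟨j + k, h.add _ _ hj hk, add_nonneg hj0 hk0, n + m, (add_le_add hn hm).trans_eq (by
      rw [add_nsmul]; abel)⟩
  pos := fun y ⟨j, hj, hj0, n, hn⟩ =>
    ⟨j, hj, hj0, n, sup_le hn (add_nonneg hj0 (nsmul_nonneg (posPart_nonneg x) n))⟩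

/-- A negative cone maximal among those avoiding `e` is total. If it contained neither `x` nor `-x`,
adjoining either would capture `e`, giving `e ≤ j + n • x⁺` and `e ≤ k + m • (-x)⁺`. Since `x⁺` and
`(-x)⁺` are disjoint, the infimum of these bounds enlarged to `j + k` is `j + k` itself, which puts
`e` in the cone. -/
theorem exists_total {J₀ : Set A} (h₀ : IsNegCone J₀) {e : A} (he : e ∉ J₀) :
    ∃ J, J₀ ⊆ J ∧ IsNegCone J ∧ e ∉ J ∧ ∀ x, x ∈ J ∨ -x ∈ J := by
  obtain ⟨J, hJ₀, hJ⟩ := zorn_subset_nonempty {J : Set A | IsNegCone J ∧ e ∉ J} (by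
    intro c hc hchain ⟨K, hK⟩
    refine ⟨⋃₀ c, ⟨⟨⟨K, hK, (hc hK).1.zero⟩, ?_, ?_, ?_⟩, ?_⟩, fun s hs =>
      Set.subset_sUnion_of_mem hs⟩
    · rintro x y hxy ⟨s, hs, hy⟩
      exact ⟨s, hs, (hc hs).1.lower x y hxy hy⟩
    · rintro x y ⟨s, hs, hx⟩ ⟨t, ht, hy⟩
      rcases hchain.total hs ht with h | h
      · exact ⟨t, ht, (hc ht).1.add x y (h hx) hy⟩
      · exact ⟨s, hs, (hc hs).1.add x y hx (h hy)⟩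
    · rintro x ⟨s, hs, hx⟩
      exact ⟨s, hs, (hc hs).1.pos x hx⟩
    · rintro ⟨s, hs, hes⟩
      exact (hc hs).2 hes) J₀ ⟨h₀, he⟩
  have hJn : IsNegCone J := hJ.prop.1
  refine ⟨J, hJ₀, hJn, hJ.prop.2, fun x => ?_⟩
  by_contra! hx
  have hmem : ∀ y, y ∉ J → ∃ j ∈ J, 0 ≤ j ∧ ∃ n : ℕ, e ≤ j + n • y⁺ := by
    intro y hy
    by_contra hcon
    exact hy (hJ.le_of_ge ⟨hJn.adjoin y, hcon⟩ (hJn.subset_adjoin y) (hJn.mem_adjoin y))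
  obtain ⟨j, hj, hj0, n, hn⟩ := hmem x hx.1
  obtain ⟨k, hk, hk0, m, hm⟩ := hmem (-x) hx.2
  refine hJ.prop.2 (hJn.lower _ _ ?_ (hJn.add _ _ hj hk))
  have hd : ∀ a b : ℕ, (a • x⁺) ⊓ (b • (-x)⁺) = 0 := by
    have h1 : x⁺ ⊓ (-x)⁺ = 0 := by simpa using posPart_inf_negPart_eq_zero x
    have h2 : ∀ (u v : A), u ⊓ v = 0 → ∀ a : ℕ, (a • u) ⊓ v = 0 := by
      intro u v huv a
      induction a with
      | zero => simpa using (huv ▸ inf_le_right : (0 : A) ≤ v)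
      | succ p ih => rw [succ_nsmul]; exact add_inf_eq_zero_of_inf_eq_zero ih huv
    intro a b
    rw [inf_comm]
    refine h2 _ _ ?_ b
    rw [inf_comm]
    exact h2 _ _ h1 a
  calc e ≤ (j + k + n • x⁺) ⊓ (j + k + m • (-x)⁺) := le_inf
        (hn.trans (add_le_add_left (le_add_of_nonneg_right hk0) _))
        (hm.trans (add_le_add_left (le_add_of_nonneg_left hj0) _))
    _ = j + k := by rw [← add_inf, hd, add_zero]

end IsNegCone

/-! ### Maximal ideals of principal ideals of vector lattices -/

section maximal
variable {A : Type*} [AddCommGroup A] [Module ℝ A] [Lattice A] [PosSMulMono ℝ A]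

theorem abs_smul_le (r : ℝ) (x : A) : |r • x| ≤ |r| • |x| := by
  have h : ∀ (s : ℝ), 0 ≤ s → ∀ y : A, |s • y| ≤ s • |y| := fun s hs y => abs_le'.2
    ⟨smul_le_smul_of_nonneg_left (le_abs_self y) hs, by
      rw [← smul_neg]; exact smul_le_smul_of_nonneg_left (neg_le_abs y) hs⟩
  rcases le_total 0 r with hr | hr
  · rw [abs_of_nonneg hr]; exact h r hr x
  · rw [abs_of_nonpos hr, ← abs_neg, ← neg_smul]; exact h _ (neg_nonneg.2 hr) x

variable [IsOrderedAddMonoid A]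

/-- The elements that are infinitesimal relative to `e` modulo the negative cone `J`. -/
def IsNegCone.infinitesimals {J : Set A} (h : IsNegCone J) {e : A} (he : 0 ≤ e) :
    Submodule ℝ A where
  carrier := {x | ∀ ε : ℝ, 0 < ε → |x| - ε • e ∈ J}
  zero_mem' := fun ε hε => by
    refine h.lower _ 0 ?_ h.zero
    rw [abs_zero, zero_sub]
    exact neg_nonpos.2 (smul_nonneg hε.le he)
  add_mem' := fun {x y} hx hy ε hε => by
    refine h.lower _ _ ?_ (h.add _ _ (hx (ε / 2) (half_pos hε)) (hy (ε / 2) (half_pos hε)))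
    rw [sub_add_sub_comm, ← add_smul, add_halves]
    exact sub_le_sub_right (abs_add_le x y) _
  smul_mem' := fun r x hx ε hε => by
    refine h.lower _ _ ?_ (h.smul (hx (ε / (|r| + 1)) (by positivity)) (abs_nonneg r))
    rw [smul_sub]
    refine sub_le_sub (abs_smul_le r x) ?_
    rw [smul_smul, ← sub_nonneg, ← sub_smul]
    refine smul_nonneg (sub_nonneg.2 ?_) he
    rw [mul_div_assoc', div_le_iff₀ (by positivity)]
    nlinarith

/-- Force `d • e ≤ z` by adjoining `d • e - z` to the cone of elements `≤ 0`, extend to a total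
preorder in which `e` is still not `≤ 0`, and let `M` consist of the infinitesimals relative to `e`.
Totality lets each element bounded by a multiple of `e` define a Dedekind cut, hence a real
coefficient modulo `M`. -/
theorem exists_maximal_ideal {e z : A} (he : 0 ≤ e) (hz : 0 ≤ z) {C : ℝ} (hC : 0 ≤ C)
    (hzC : z ≤ C • e) {d : ℝ} (hd : 0 < d) (hzd : ¬ z ≤ d • e) :
    ∃ M : Submodule ℝ A, (∀ x y, |x| ≤ |y| → y ∈ M → x ∈ M) ∧ z ∉ M ∧
      ∀ x (c : ℝ), |x| ≤ c • e → ∃ l : ℝ, x - l • e ∈ M := by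
  have h0 : IsNegCone (Set.Iic (0 : A)) :=
    ⟨le_rfl, fun x y hxy hy => hxy.trans hy, fun x y hx hy => add_nonpos hx hy,
      fun x hx => (posPart_eq_zero.2 hx).le⟩
  -- If `e` were captured, it would be disjoint from `(d • e - z)⁻`. That negative part lies below
  -- `z ≤ C • e`, so it would vanish, giving `z ≤ d • e`.
  have he0 : e ∉ {y | ∃ j ∈ Set.Iic (0 : A), 0 ≤ j ∧ ∃ n : ℕ, y ≤ j + n • (d • e - z)⁺} := by
    rintro ⟨j, hj, -, n, hn⟩
    have hn' : e ≤ (n : ℝ) • (d • e - z)⁺ := by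
      rw [Nat.cast_smul_eq_nsmul]
      exact hn.trans (add_le_of_nonpos_left hj)
    have h1 := smul_inf_eq_zero_of_inf_eq_zero n.cast_nonneg
      (posPart_inf_negPart_eq_zero (d • e - z))
    have h2 : e ⊓ (d • e - z)⁻ = 0 := le_antisymm ((inf_le_inf_right _ hn').trans h1.le)
      (le_inf he (negPart_nonneg _))
    have h3 := smul_inf_eq_zero_of_inf_eq_zero hC h2
    have h4 : (d • e - z)⁻ ≤ z := by
      rw [negPart_def, neg_sub]
      exact sup_le (sub_le_self _ (smul_nonneg hd.le he)) hz
    rw [inf_eq_right.2 (h4.trans hzC)] at h3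
    exact hzd (sub_nonneg.1 (negPart_eq_zero.1 h3))
  obtain ⟨J, hJ₀, hJ, heJ, htot⟩ := (h0.adjoin (d • e - z)).exists_total he0
  have hpos : ∀ r : ℝ, r • e ∈ J → r ≤ 0 := by
    intro r hr
    by_contra! hr0
    refine heJ ?_
    have := hJ.smul hr (inv_nonneg.2 hr0.le)
    rwa [inv_smul_smul₀ hr0.ne'] at this
  refine ⟨hJ.infinitesimals he, fun x y hxy hy ε hε =>
    hJ.lower _ _ (sub_le_sub_right hxy _) (hy ε hε), fun hzM => ?_, fun x c hx => ?_⟩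
  -- An infinitesimal `z` would satisfy `z ≤ (d / 2) • e` in the preorder, while `d • e ≤ z` was
  -- forced; together they give `(d / 2) • e ∈ J`.
  · have h1 := hJ.add _ _ (hzM (d / 2) (half_pos hd)) (hJ₀ (h0.mem_adjoin (d • e - z)))
    rw [abs_of_nonneg hz] at h1
    have h2 : z - (d / 2) • e + (d • e - z) = (d / 2) • e := by module
    rw [h2] at h1
    linarith [hpos _ h1]
  -- Lower half of the cut of `x`: the reals `l` with `l • e ≤ x` modulo `J`. Its supremum is the
  -- coefficient of `x`.
  · let S : Set ℝ := {l | l • e - x ∈ J}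
    have hne : S.Nonempty := ⟨-c, hJ.lower _ 0 (by
      rw [neg_smul, sub_nonpos, neg_le]
      exact (neg_le_abs x).trans hx) hJ.zero⟩
    have hbdd : BddAbove S := ⟨c, fun l hl => by
      have h1 : x - c • e ∈ J := hJ.lower _ 0 (sub_nonpos.2 ((le_abs_self x).trans hx)) hJ.zero
      have h2 := hJ.add _ _ hl h1
      rw [sub_add_sub_cancel, ← sub_smul] at h2
      linarith [hpos _ h2]⟩
    refine ⟨sSup S, fun ε hε => ?_⟩
    have h1 : x - sSup S • e - ε • e ∈ J := by
      have : sSup S + ε ∉ S := fun h => by linarith [le_csSup hbdd h]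
      have h2 := (htot ((sSup S + ε) • e - x)).resolve_left this
      rwa [neg_sub, add_smul, ← sub_sub] at h2
    have h2 : -(x - sSup S • e) - ε • e ∈ J := by
      obtain ⟨l, hl, hlt⟩ := exists_lt_of_lt_csSup hne (sub_lt_self (sSup S) hε)
      refine hJ.lower _ _ ?_ hl
      rw [← sub_nonneg]
      have : l • e - x - (-(x - sSup S • e) - ε • e) = (l - (sSup S - ε)) • e := by module
      rw [this]
      exact smul_nonneg (by linarith) he
    refine hJ.lower _ _ ?_ (hJ.sup h1 h2)
    rw [← sup_sub]
    exact le_rfl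

end maximal

/-! ### Lattice-algebra terms -/

/-- Formal lattice-algebra expressions in the variables `X`. -/
inductive LatticeAlgTerm (X : Type*) : Type _
  | var (x : X) : LatticeAlgTerm X
  | zero : LatticeAlgTerm X
  | add (s t : LatticeAlgTerm X) : LatticeAlgTerm X
  | smul (r : ℝ) (t : LatticeAlgTerm X) : LatticeAlgTerm X
  | mul (s t : LatticeAlgTerm X) : LatticeAlgTerm X
  | sup (s t : LatticeAlgTerm X) : LatticeAlgTerm X
  | inf (s t : LatticeAlgTerm X) : LatticeAlgTerm X

namespace LatticeAlgTerm
variable {X : Type*}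

/-- The variables occurring in a term. -/
def vars : LatticeAlgTerm X → Set X
  | var x => {x}
  | zero => ∅
  | add s t => vars s ∪ vars t
  | smul _ t => vars t
  | mul s t => vars s ∪ vars t
  | sup s t => vars s ∪ vars t
  | inf s t => vars s ∪ vars t

theorem finite_vars : ∀ t : LatticeAlgTerm X, (vars t).Finite
  | var x => Set.finite_singleton x
  | zero => Set.finite_empty
  | add s t => (finite_vars s).union (finite_vars t)
  | smul _ t => finite_vars t
  | mul s t => (finite_vars s).union (finite_vars t)
  | sup s t => (finite_vars s).union (finite_vars t)
  | inf s t => (finite_vars s).union (finite_vars t)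

/-- Evaluation of a term in an `f`-algebra. -/
def eval {A : Type*} [NonUnitalRing A] [Module ℝ A] [Lattice A] (v : X → A) :
    LatticeAlgTerm X → A
  | var x => v x
  | zero => 0
  | add s t => eval v s + eval v t
  | smul r t => r • eval v t
  | mul s t => eval v s * eval v t
  | sup s t => eval v s ⊔ eval v t
  | inf s t => eval v s ⊓ eval v t

/-- Evaluation of a term in the `f`-algebra `ℝ` with the product `(x, y) ↦ w * (x * y)`. -/
def weightedEval (w : ℝ) (v : X → ℝ) : LatticeAlgTerm X → ℝ
  | var x => v x
  | zero => 0
  | add s t => weightedEval w v s + weightedEval w v t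
  | smul r t => r * weightedEval w v t
  | mul s t => w * (weightedEval w v s * weightedEval w v t)
  | sup s t => weightedEval w v s ⊔ weightedEval w v t
  | inf s t => weightedEval w v s ⊓ weightedEval w v t

theorem continuous_weightedEval (v : X → ℝ) (t : LatticeAlgTerm X) :
    Continuous fun w => weightedEval w v t := by
  induction t with
  | var x => exact continuous_const
  | zero => exact continuous_const
  | add s t hs ht => exact hs.add ht
  | smul r t ht => exact continuous_const.mul ht
  | mul s t hs ht => exact continuous_id.mul (hs.mul ht)
  | sup s t hs ht => exact hs.sup ht
  | inf s t hs ht => exact hs.inf ht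

/-- Scaling by `w` is a homomorphism from the weighted product to the usual one, because `w * (w *
(x * y)) = (w * x) * (w * y)`; it respects `⊔` and `⊓` because `0 ≤ w`. -/
theorem weightedEval_one_mul {w : ℝ} (hw : 0 ≤ w) (v : X → ℝ) (t : LatticeAlgTerm X) :
    weightedEval 1 (fun x => w * v x) t = w * weightedEval w v t := by
  induction t with
  | var x => rfl
  | zero => exact (mul_zero w).symm
  | add s t hs ht => simp only [weightedEval, hs, ht, mul_add]
  | smul r t ht => simp only [weightedEval, ht, mul_left_comm]
  | mul s t hs ht => simp only [weightedEval, hs, ht]; ring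
  | sup s t hs ht => simp only [weightedEval, hs, ht]; exact (mul_max_of_nonneg _ _ hw).symm
  | inf s t hs ht => simp only [weightedEval, hs, ht]; exact (mul_min_of_nonneg _ _ hw).symm

/-- For `w > 0` the factor `w` cancels in the rescaling identity. For `w = 0`, where the product is
zero and no rescaling is available, continuity in `w` gives the result. -/
theorem weightedEval_eq_zero {v : X → ℝ} {t : LatticeAlgTerm X}
    (h : ∀ w : ℝ, weightedEval 1 (fun x => w * v x) t = 0) {w : ℝ} (hw : 0 ≤ w) :
    weightedEval w v t = 0 := by
  have hpos : ∀ w : ℝ, 0 < w → weightedEval w v t = 0 := fun w hw =>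
    (mul_eq_zero.1 ((weightedEval_one_mul hw.le v t).symm.trans (h w))).resolve_left hw.ne'
  have hcl : IsClosed {w : ℝ | weightedEval w v t = 0} :=
    isClosed_eq (continuous_weightedEval v t) continuous_const
  have hsub : closure (Set.Ioi (0 : ℝ)) ⊆ {w : ℝ | weightedEval w v t = 0} :=
    closure_minimal (fun w hw => hpos w hw) hcl
  rw [closure_Ioi] at hsub
  exact hsub hw

section map
variable {A B : Type*} [NonUnitalRing A] [Module ℝ A] [Lattice A]
  [NonUnitalRing B] [Module ℝ B] [Lattice B]

theorem _root_.IsLatticeAlgHom.map_eval {φ : A →ₗ[ℝ] B} (hφ : IsLatticeAlgHom φ) (v : X → A)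
    (t : LatticeAlgTerm X) : φ (eval v t) = eval (fun x => φ (v x)) t := by
  induction t with
  | var x => rfl
  | zero => exact map_zero φ
  | add s t hs ht => simp only [eval, map_add, hs, ht]
  | smul r t ht => simp only [eval, map_smul, ht]
  | mul s t hs ht => simp only [eval, hφ.map_mul, hs, ht]
  | sup s t hs ht => simp only [eval, hφ.map_sup, hs, ht]
  | inf s t hs ht => simp only [eval, hφ.map_inf, hs, ht]

end map

/-! ### Vanishing of terms in normed `f`-algebras -/

section normed
variable {A : Type*} [NonUnitalNormedRing A] [NormedSpace ℝ A] [Lattice A] [IsFAlgebra A]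
    [HasSolidNorm A]

theorem exists_abs_eval_le {e : A} (v : X → A) (t : LatticeAlgTerm X)
    (h : ∀ x ∈ vars t, |v x| ≤ e) : ∃ C : ℝ, 0 ≤ C ∧ |eval v t| ≤ C • e := by
  have aux : ∀ a b c : A, |c| ≤ |a| + |b| → (∃ C : ℝ, 0 ≤ C ∧ |a| ≤ C • e) →
      (∃ C : ℝ, 0 ≤ C ∧ |b| ≤ C • e) → ∃ C : ℝ, 0 ≤ C ∧ |c| ≤ C • e := by
    rintro a b c hc ⟨C, hC, ha⟩ ⟨D, hD, hb⟩
    exact ⟨C + D, add_nonneg hC hD, hc.trans ((add_le_add ha hb).trans_eq (add_smul C D e).symm)⟩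
  induction t with
  | var x => exact ⟨1, zero_le_one, by rw [one_smul]; exact h x rfl⟩
  | zero => exact ⟨0, le_rfl, by simp [eval]⟩
  | add s t hs ht =>
    exact aux _ _ _ (abs_add_le _ _) (hs fun x hx => h x (Or.inl hx))
      (ht fun x hx => h x (Or.inr hx))
  | smul r t ht =>
    obtain ⟨C, hC, hb⟩ := ht h
    refine ⟨|r| * C, by positivity, (abs_smul_le r _).trans ?_⟩
    rw [mul_smul]
    exact smul_le_smul_of_nonneg_left hb (abs_nonneg r)
  | mul s t hs ht =>
    obtain ⟨C, hC, hb⟩ := ht fun x hx => h x (Or.inr hx)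
    refine ⟨(‖eval v s‖ + 1) * C, by positivity,
      (IsFAlgebra.abs_mul_le_smul_right (lt_add_one _) _).trans ?_⟩
    rw [mul_smul]
    exact smul_le_smul_of_nonneg_left hb (by positivity)
  | sup s t hs ht =>
    refine aux _ _ _ (abs_le'.2 ⟨_root_.sup_le ?_ ?_, ?_⟩) (hs fun x hx => h x (Or.inl hx))
      (ht fun x hx => h x (Or.inr hx))
    · exact (le_abs_self _).trans (le_add_of_nonneg_right (abs_nonneg _))
    · exact (le_abs_self _).trans (le_add_of_nonneg_left (abs_nonneg _))
    · exact ((neg_le_neg le_sup_left).trans (neg_le_abs _)).trans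
        (le_add_of_nonneg_right (abs_nonneg _))
  | inf s t hs ht =>
    refine aux _ _ _ (abs_le'.2 ⟨?_, ?_⟩) (hs fun x hx => h x (Or.inl hx))
      (ht fun x hx => h x (Or.inr hx))
    · exact (inf_le_left.trans (le_abs_self _)).trans (le_add_of_nonneg_right (abs_nonneg _))
    · simp only [eval]
      rw [neg_inf]
      exact _root_.sup_le ((neg_le_abs _).trans (le_add_of_nonneg_right (abs_nonneg _)))
        ((neg_le_abs _).trans (le_add_of_nonneg_left (abs_nonneg _)))

/-- Calculation modulo `M`, which is a two-sided ring ideal because multiplications are dominated by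
scalars. Modulo `M` the variables are multiples of `e` and `e * e` is `w • e`, so a term evaluates
as in `ℝ` with the weighted product. -/
theorem eval_sub_smul_mem {M : Submodule ℝ A} (hM : ∀ x y, |x| ≤ |y| → y ∈ M → x ∈ M) {e : A}
    (he : 0 ≤ e) {w : ℝ} (hw : e * e - w • e ∈ M) {v : X → A} {u : X → ℝ} (t : LatticeAlgTerm X)
    (h : ∀ x ∈ vars t, v x - u x • e ∈ M) : eval v t - weightedEval w u t • e ∈ M := by
  have habs : ∀ x ∈ M, |x| ∈ M := fun x hx => hM _ _ (abs_abs x).le hx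
  have hmul_left : ∀ a x, x ∈ M → a * x ∈ M := fun a x hx => by
    refine hM _ _ ?_ (M.smul_mem (‖a‖ + 1) (habs x hx))
    exact (IsFAlgebra.abs_mul_le_smul_right (lt_add_one _) x).trans (le_abs_self _)
  have hmul_right : ∀ a x, x ∈ M → x * a ∈ M := fun a x hx => by
    refine hM _ _ ?_ (M.smul_mem (‖a‖ + 1) (habs x hx))
    exact (IsFAlgebra.abs_mul_le_smul_left (lt_add_one _) x).trans (le_abs_self _)
  have hmono : Monotone fun r : ℝ => r • e := fun r s hrs => by
    change r • e ≤ s • e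
    rw [← sub_nonneg, ← sub_smul]
    exact smul_nonneg (sub_nonneg.2 hrs) he
  have hsup : ∀ a b c : A, |a| ≤ |b| + |c| → b ∈ M → c ∈ M → a ∈ M := fun a b c ha hb hc =>
    hM _ _ (ha.trans (le_abs_self _)) (M.add_mem (habs b hb) (habs c hc))
  induction t with
  | var x => exact h x rfl
  | zero => simp [eval, weightedEval]
  | add s t hs ht =>
    have := M.add_mem (hs fun x hx => h x (Or.inl hx)) (ht fun x hx => h x (Or.inr hx))
    rwa [sub_add_sub_comm, ← add_smul] at this
  | smul r t ht =>
    have := M.smul_mem r (ht h)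
    rwa [smul_sub, smul_smul] at this
  | mul s t hs ht =>
    have h1 := hmul_right (eval v t) _ (hs fun x hx => h x (Or.inl hx))
    have h2 := hmul_left (weightedEval w u s • e) _ (ht fun x hx => h x (Or.inr hx))
    have h3 := M.smul_mem (weightedEval w u s * weightedEval w u t) hw
    convert M.add_mem (M.add_mem h1 h2) h3 using 1
    simp only [eval, weightedEval, sub_mul, mul_sub, smul_mul_assoc, mul_smul_comm, smul_sub,
      smul_smul]
    rw [mul_comm w, mul_comm (weightedEval w u t)]
    abel
  | sup s t hs ht =>
    refine hsup _ _ _ ?_ (hs fun x hx => h x (Or.inl hx)) (ht fun x hx => h x (Or.inr hx))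
    simp only [eval, weightedEval]
    rw [hmono.map_sup]
    refine (le_of_eq_of_le ?_ (abs_add_le _ _)).trans (add_le_add
      (abs_sup_sub_sup_le_abs _ _ (eval v t))
      (abs_sup_sub_sup_le_abs _ _ (weightedEval w u s • e)))
    rw [sup_comm (weightedEval w u s • e) (eval v t),
      sup_comm (weightedEval w u s • e), sub_add_sub_cancel]
  | inf s t hs ht =>
    refine hsup _ _ _ ?_ (hs fun x hx => h x (Or.inl hx)) (ht fun x hx => h x (Or.inr hx))
    simp only [eval, weightedEval]
    rw [hmono.map_inf]
    refine (le_of_eq_of_le ?_ (abs_add_le _ _)).trans (add_le_add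
      (abs_inf_sub_inf_le_abs _ _ (eval v t))
      (abs_inf_sub_inf_le_abs _ _ (weightedEval w u s • e)))
    rw [inf_comm (weightedEval w u s • e) (eval v t),
      inf_comm (weightedEval w u s • e), sub_add_sub_cancel]

theorem eval_eq_zero {E : Type*} [NormedAddCommGroup E] [NormedSpace ℝ E] (T : E →ₗ[ℝ] A)
    (t : LatticeAlgTerm E) (h : ∀ ω : StrongDual ℝ E, weightedEval 1 ω t = 0) :
    eval T t = 0 := by
  by_contra hne
  set s := (finite_vars t).toFinset with hs
  set e : A := ∑ x ∈ s, |T x|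
  have he : 0 ≤ e := Finset.sum_nonneg fun x _ => abs_nonneg _
  have hvar : ∀ x ∈ vars t, |T x| ≤ e := fun x hx =>
    Finset.single_le_sum (f := fun x => |T x|) (fun x _ => abs_nonneg _) (by simpa [hs] using hx)
  obtain ⟨C, hC, hz⟩ := exists_abs_eval_le T t hvar
  obtain ⟨d, hd, hzd⟩ : ∃ d : ℝ, 0 < d ∧ ¬ |eval T t| ≤ d • e := by
    have hz0 : 0 < ‖eval T t‖ := norm_pos_iff.2 hne
    -- With this `d` one has `‖d • e‖ < ‖eval T t‖`, so solidity of the norm excludes the bound.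
    refine ⟨‖eval T t‖ / (2 * (‖e‖ + 1)), by positivity, fun hle => ?_⟩
    have h1 := norm_le_norm_of_abs_le_abs
      (hle.trans (le_abs_self _))
    rw [norm_smul, Real.norm_of_nonneg (by positivity), div_mul_eq_mul_div,
      le_div_iff₀ (by positivity)] at h1
    nlinarith [norm_nonneg e]
  obtain ⟨M, hM, hzM, hex⟩ := exists_maximal_ideal he (abs_nonneg _) hC hz hd hzd
  have heM : e ∉ M := fun heM => hzM (hM _ _ (by
    rw [abs_abs]; exact hz.trans (le_abs_self _)) (M.smul_mem C heM))
  have huniq : ∀ l : ℝ, l • e ∈ M → l = 0 := fun l hl => by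
    by_contra hl0
    have := M.smul_mem l⁻¹ hl
    rw [inv_smul_smul₀ hl0] at this
    exact heM this
  obtain ⟨w, hw⟩ := hex (e * e) (‖e‖ + 1) (by
    have := IsFAlgebra.abs_mul_le_smul_right (lt_add_one ‖e‖) e
    rwa [abs_of_nonneg he] at this)
  -- If `w < 0`, then `0 ≤ (-w) • e ≤ e * e - w • e` would put a nonzero multiple of `e` in `M`.
  have hw0 : 0 ≤ w := by
    by_contra! hneg
    have h1 : (-w) • e ∈ M := by
      refine hM _ _ ?_ hw
      have h2 : 0 ≤ (-w) • e := smul_nonneg (by linarith) he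
      have h3 : (-w) • e ≤ e * e - w • e := by
        rw [neg_smul, sub_eq_add_neg]
        exact le_add_of_nonneg_left (IsFAlgebra.mul_nonneg_of_nonneg _ _ he he)
      rw [abs_of_nonneg h2]
      exact h3.trans (le_abs_self _)
    have := huniq _ h1
    linarith
  let V : Submodule ℝ E := Submodule.span ℝ s
  have hV : ∀ x : V, ∃ l : ℝ, T x - l • e ∈ M := by
    rintro ⟨x, hx⟩
    refine Submodule.span_induction (p := fun x _ => ∃ l : ℝ, T x - l • e ∈ M) ?_ ?_ ?_ ?_ hx
    · intro x hx
      exact hex _ 1 (by rw [one_smul]; exact hvar x (by simpa [hs] using hx))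
    · exact ⟨0, by simp⟩
    · rintro x y - - ⟨l, hl⟩ ⟨m, hm⟩
      refine ⟨l + m, ?_⟩
      have := M.add_mem hl hm
      rwa [sub_add_sub_comm, ← add_smul, ← map_add] at this
    · rintro r x - ⟨l, hl⟩
      refine ⟨r * l, ?_⟩
      have := M.smul_mem r hl
      rwa [smul_sub, smul_smul, ← map_smul] at this
  choose l hl using hV
  have hl_eq : ∀ (x : V) (m : ℝ), T x - m • e ∈ M → l x = m := fun x m hm => by
    have := M.sub_mem hm (hl x)
    rw [sub_sub_sub_cancel_left, ← sub_smul] at this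
    exact sub_eq_zero.1 (huniq _ this)
  let ψ : V →ₗ[ℝ] ℝ :=
    { toFun := l
      map_add' := fun x y => hl_eq _ _ (by
        have := M.add_mem (hl x) (hl y)
        rwa [sub_add_sub_comm, ← add_smul, ← map_add] at this)
      map_smul' := fun r x => hl_eq _ _ (by
        have := M.smul_mem r (hl x)
        rwa [smul_sub, smul_smul, ← map_smul] at this) }
  -- Only finitely many variables occur, so `ψ` is automatically continuous and Hahn–Banach applies,
  -- although `T` itself is merely linear.
  have : FiniteDimensional ℝ V := FiniteDimensional.span_finset ℝ s
  obtain ⟨ω, hω, -⟩ := exists_extension_norm_eq V ψ.toContinuousLinearMap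
  have hmem := eval_sub_smul_mem hM he hw (v := T) (u := ω) t fun x hx => by
    have hxV : x ∈ V := Submodule.subset_span (by simpa [hs] using hx)
    have : ω x = l ⟨x, hxV⟩ := hω ⟨x, hxV⟩
    rw [this]
    exact hl ⟨x, hxV⟩
  rw [weightedEval_eq_zero (v := ω) (fun r => h (r • ω)) hw0, zero_smul, sub_zero] at hmem
  exact hzM (hM _ _ (abs_abs _).le hmem)

end normed
end LatticeAlgTerm

/-! ### Positive operators on Banach lattices -/

theorem LinearMap.continuous_of_monotone {F A : Type*} [NormedAddCommGroup F] [NormedSpace ℝ F]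
    [Lattice F] [IsOrderedAddMonoid F] [PosSMulMono ℝ F] [HasSolidNorm F] [CompleteSpace F]
    [NormedAddCommGroup A] [NormedSpace ℝ A] [Lattice A] [IsOrderedAddMonoid A] [HasSolidNorm A]
    (S : F →ₗ[ℝ] A) (hS : Monotone S) : Continuous S := by
  by_contra hcont
  have hunb : ∀ C : ℝ, ∃ x : F, C * ‖x‖ < ‖S x‖ := by
    intro C
    by_contra! h
    exact hcont (AddMonoidHomClass.continuous_of_bound S C h)
  have hpos : ∀ x, 0 ≤ x → 0 ≤ S x := fun x hx => (map_zero S).symm.le.trans (hS hx)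
  have hsolid : ∀ x y, 0 ≤ x → x ≤ y → ‖S x‖ ≤ ‖S y‖ := fun x y hx hxy =>
    norm_le_norm_of_abs_le_abs <| by
      rw [abs_of_nonneg (hpos x hx)]
      exact (hS hxy).trans (le_abs_self _)
  have hseq : ∀ n : ℕ, ∃ y : F, 0 ≤ y ∧ ‖y‖ = (1 / 2) ^ n ∧ (n : ℝ) ≤ ‖S y‖ := by
    intro n
    obtain ⟨x, hx⟩ := hunb (n * 2 ^ n)
    have hx0 : 0 < ‖x‖ := by
      refine norm_pos_iff.2 fun h => ?_
      simp [h] at hx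
    have habs : ‖S x‖ ≤ ‖S |x|‖ := norm_le_norm_of_abs_le_abs <| by
      refine (abs_le'.2 ⟨hS (le_abs_self x), ?_⟩).trans (le_abs_self _)
      rw [← map_neg]
      exact hS (neg_le_abs x)
    refine ⟨((1 / 2) ^ n / ‖x‖) • |x|, smul_nonneg (by positivity) (abs_nonneg x), ?_, ?_⟩
    · rw [norm_smul, Real.norm_of_nonneg (by positivity), norm_abs_eq_norm,
        div_mul_cancel₀ _ hx0.ne']
    · rw [map_smul, norm_smul, Real.norm_of_nonneg (by positivity), div_mul_eq_mul_div,
        le_div_iff₀ hx0, one_div, inv_pow, inv_mul_eq_div, le_div_iff₀ (by positivity)]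
      linarith
  choose y hy0 hyn hyS using hseq
  have hsum : Summable y := Summable.of_norm (by
    simpa only [hyn] using summable_geometric_two)
  obtain ⟨n, hn⟩ := exists_nat_gt ‖S (∑' n, y n)‖
  exact absurd ((hyS n).trans (hsolid _ _ (hy0 n) (hsum.le_tsum n fun m _ => hy0 m)))
    (not_le.2 hn)

/-! ### Basic properties of lattice-algebra homomorphisms -/

namespace IsLatticeAlgHom
variable {A B C : Type*} [NonUnitalRing A] [Module ℝ A] [Lattice A]
  [NonUnitalRing B] [Module ℝ B] [Lattice B] [NonUnitalRing C] [Module ℝ C] [Lattice C]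

theorem comp {ψ : B →ₗ[ℝ] C} {φ : A →ₗ[ℝ] B} (hψ : IsLatticeAlgHom ψ) (hφ : IsLatticeAlgHom φ) :
    IsLatticeAlgHom (ψ ∘ₗ φ) where
  map_mul a b := by simp only [LinearMap.comp_apply, hφ.map_mul, hψ.map_mul]
  map_sup a b := by simp only [LinearMap.comp_apply, hφ.map_sup, hψ.map_sup]
  map_inf a b := by simp only [LinearMap.comp_apply, hφ.map_inf, hψ.map_inf]

theorem zero : IsLatticeAlgHom (0 : A →ₗ[ℝ] B) where
  map_mul a b := by simp
  map_sup a b := by simp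
  map_inf a b := by simp

theorem monotone {φ : A →ₗ[ℝ] B} (hφ : IsLatticeAlgHom φ) : Monotone φ := fun a b h => by
  rw [← sup_eq_right, ← hφ.map_sup, sup_eq_right.2 h]

theorem map_abs {φ : A →ₗ[ℝ] B} (hφ : IsLatticeAlgHom φ) (a : A) : φ |a| = |φ a| :=
  (hφ.map_sup a (-a)).trans (congrArg (φ a ⊔ ·) (map_neg φ a))

end IsLatticeAlgHom

/-! ### The universal property of `FAFA E` -/

namespace FAFA
open LatticeAlgTerm
variable {E : Type*} [NormedAddCommGroup E] [NormedSpace ℝ E]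

theorem exists_eval_eq (f : FAFA E) : ∃ t : LatticeAlgTerm E, eval δ t = f := by
  refine induction (p := fun f => ∃ t : LatticeAlgTerm E, eval δ t = f) (fun x => ⟨var x, rfl⟩)
    ⟨zero, rfl⟩ ?_ ?_ ?_ ?_ ?_ f
  · rintro _ _ ⟨s, rfl⟩ ⟨t, rfl⟩
    exact ⟨add s t, rfl⟩
  · rintro r _ ⟨t, rfl⟩
    exact ⟨smul r t, rfl⟩
  · rintro _ _ ⟨s, rfl⟩ ⟨t, rfl⟩
    exact ⟨mul s t, rfl⟩
  · rintro _ _ ⟨s, rfl⟩ ⟨t, rfl⟩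
    exact ⟨sup s t, rfl⟩
  · rintro _ _ ⟨s, rfl⟩ ⟨t, rfl⟩
    exact ⟨inf s t, rfl⟩

theorem val_eval (ω : StrongDual ℝ E) (t : LatticeAlgTerm E) :
    (eval δ t : FAFA E).val ω = weightedEval 1 ω t := by
  induction t with
  | var x => rfl
  | zero => rfl
  | add s t hs ht => simp only [eval, weightedEval, val_add, hs, ht]
  | smul r t ht => simp only [eval, weightedEval, val_smul, ht]
  | mul s t hs ht => simp only [eval, weightedEval, val_mul, hs, ht, one_mul]
  | sup s t hs ht => simp only [eval, weightedEval, val_sup, hs, ht]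
  | inf s t hs ht => simp only [eval, weightedEval, val_inf, hs, ht]

theorem hom_ext {A : Type*} [NonUnitalRing A] [Module ℝ A] [Lattice A] {φ ψ : FAFA E →ₗ[ℝ] A}
    (hφ : IsLatticeAlgHom φ) (hψ : IsLatticeAlgHom ψ) (h : ∀ x, φ (δ x) = ψ (δ x)) : φ = ψ := by
  ext f
  obtain ⟨t, rfl⟩ := exists_eval_eq f
  rw [hφ.map_eval, hψ.map_eval, funext h]

section lift
variable {A : Type*} [NonUnitalNormedRing A] [NormedSpace ℝ A] [Lattice A] [IsFAlgebra A]
    [HasSolidNorm A]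

/-- The value at `T` does not depend on the term chosen to represent an element of `FAFA E`; this
makes `lift` a homomorphism despite the arbitrary choice. -/
theorem eval_eq_eval (T : E →ₗ[ℝ] A) {s t : LatticeAlgTerm E}
    (h : (eval δ s : FAFA E) = eval δ t) : eval T s = eval T t := by
  have := eval_eq_zero T (add s (smul (-1) t)) fun ω => by
    simp only [weightedEval, ← val_eval, h]
    ring
  simpa [eval, ← sub_eq_add_neg, sub_eq_zero] using this

/-- A term representing an element of `FAFA E`. -/
def term (f : FAFA E) : LatticeAlgTerm E := (exists_eval_eq f).choose

theorem eval_term (f : FAFA E) : eval δ (term f) = f := (exists_eval_eq f).choose_spec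

/-- The lattice-algebra homomorphism `FAFA E → A` extending a linear map `E → A`. -/
def lift (T : E →ₗ[ℝ] A) : FAFA E →ₗ[ℝ] A where
  toFun f := eval T (term f)
  map_add' f g := eval_eq_eval T (t := add (term f) (term g)) (by
    simp only [eval, eval_term])
  map_smul' r f := eval_eq_eval T (t := smul r (term f)) (by
    simp only [eval, eval_term])

theorem lift_δ (T : E →ₗ[ℝ] A) (x : E) : lift T (δ x) = T x :=
  eval_eq_eval T (t := var x) (eval_term _)

theorem isLatticeAlgHom_lift (T : E →ₗ[ℝ] A) : IsLatticeAlgHom (lift T) where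
  map_mul f g := eval_eq_eval T (t := mul (term f) (term g)) (by
    simp only [eval, eval_term])
  map_sup f g := eval_eq_eval T (t := sup (term f) (term g)) (by
    simp only [eval, eval_term])
  map_inf f g := eval_eq_eval T (t := inf (term f) (term g)) (by
    simp only [eval, eval_term])

theorem norm_lift_le (T : E →L[ℝ] A) (hT : ‖T‖ ≤ 1) (f : FAFA E) :
    ‖lift (T : E →ₗ[ℝ] A) f‖ ≤ ‖T‖ * ρ E f := by
  have hφ := isLatticeAlgHom_lift (T : E →ₗ[ℝ] A)
  -- The rescaled seminorm needs `‖T‖ ≠ 0`; for `T = 0` the extension is zero.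
  rcases (norm_nonneg T).eq_or_lt with h0 | h0
  · have hT0 : T = 0 := norm_eq_zero.1 h0.symm
    have : lift (T : E →ₗ[ℝ] A) = 0 := hom_ext hφ .zero fun x => by simp [lift_δ, hT0]
    rw [this, ← h0]
    simp
  · let ν : Seminorm ℝ (FAFA E) := Seminorm.of (fun f => ‖T‖⁻¹ * ‖lift (T : E →ₗ[ℝ] A) f‖)
      (fun f g => by
        rw [map_add, ← mul_add]
        exact mul_le_mul_of_nonneg_left (norm_add_le _ _) (by positivity))
      (fun r f => by rw [map_smul, norm_smul, mul_left_comm])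
    have hν : IsAdmissible ν :=
      { solid := fun f g h => by
          refine mul_le_mul_of_nonneg_left (norm_le_norm_of_abs_le_abs ?_) (by positivity)
          rw [← hφ.map_abs, ← hφ.map_abs]
          exact hφ.monotone h
        mul_le := fun f g => by
          change ‖T‖⁻¹ * ‖lift (T : E →ₗ[ℝ] A) (f * g)‖ ≤
            (‖T‖⁻¹ * ‖lift (T : E →ₗ[ℝ] A) f‖) * (‖T‖⁻¹ * ‖lift (T : E →ₗ[ℝ] A) g‖)
          rw [hφ.map_mul, mul_assoc]
          refine mul_le_mul_of_nonneg_left ((norm_mul_le _ _).trans ?_) (by positivity)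
          refine mul_le_mul_of_nonneg_left ?_ (norm_nonneg _)
          -- Submultiplicativity survives the rescaling because the additional factor `‖T‖⁻¹` is at
          -- least `1`; this is where `‖T‖ ≤ 1` enters.
          exact le_mul_of_one_le_left (norm_nonneg _) ((one_le_inv₀ h0).2 hT)
        le_norm := fun x => by
          change ‖T‖⁻¹ * ‖lift (T : E →ₗ[ℝ] A) (δ x)‖ ≤ ‖x‖
          rw [lift_δ, inv_mul_le_iff₀ h0]
          exact T.le_opNorm x }
    have h := le_iSup_admissible hν f
    rw [← ρ_apply] at h
    exact (inv_mul_le_iff₀ h0).1 h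

end lift

/-- Evaluation at a functional of norm at most `1` gives an admissible seminorm `f ↦ |f ω|`; a
norming functional for `x` gives the lower bound. -/
theorem ρ_δ (x : E) : ρ E (δ x) = ‖x‖ := by
  refine le_antisymm (isAdmissible_ρ.le_norm x) ?_
  obtain ⟨ω, hω, hx⟩ := exists_dual_vector'' ℝ x
  let ν : Seminorm ℝ (FAFA E) := Seminorm.of (fun f => |f.val ω|)
    (fun f g => abs_add_le _ _) (fun r f => abs_mul _ _)
  have hν : IsAdmissible ν :=
    { solid := fun f g h => le_iff.1 h ω
      mul_le := fun f g => (abs_mul _ _).le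
      le_norm := fun x => (ω.le_opNorm x).trans (mul_le_of_le_one_left (norm_nonneg x) hω) }
  refine le_trans (le_of_eq ?_) (le_iSup_admissible hν (δ x))
  change ‖x‖ = |ω x|
  rw [hx]
  exact (abs_norm x).symm

end FAFA

/-! ### The universal property of `FNFA E` -/

namespace FNFA
variable {E : Type*} [NormedAddCommGroup E] [NormedSpace ℝ E]

theorem isLatticeAlgHom_q : IsLatticeAlgHom (q E) := ⟨q_mul, q_sup, q_inf⟩

theorem norm_η (x : E) : ‖η E x‖ = ‖x‖ := (norm_q _).trans (FAFA.ρ_δ x)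

theorem hom_ext {A : Type*} [NonUnitalRing A] [Module ℝ A] [Lattice A] {φ ψ : FNFA E →ₗ[ℝ] A}
    (hφ : IsLatticeAlgHom φ) (hψ : IsLatticeAlgHom ψ) (h : ∀ x, φ (η E x) = ψ (η E x)) :
    φ = ψ := by
  have := FAFA.hom_ext (hφ.comp isLatticeAlgHom_q) (hψ.comp isLatticeAlgHom_q) h
  exact LinearMap.cancel_right q_surjective |>.1 this

theorem isFreeNormedFAlgebra (E : Type u) [NormedAddCommGroup E] [NormedSpace ℝ E] :
    IsFreeNormedFAlgebra.{u, u, w} E (FNFA E) (η E) where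
  isometry := norm_η
  lift A _ _ _ _ _ T hT := by
    have hφ := FAFA.isLatticeAlgHom_lift (T : E →ₗ[ℝ] A)
    have hb := FAFA.norm_lift_le T hT
    set φ := FAFA.lift (T : E →ₗ[ℝ] A)
    -- The bound by `‖T‖ * ρ` makes `φ` vanish on the kernel of `ρ`, so it descends to the quotient.
    have hker : ∀ f g, q E f = q E g → φ f = φ g := fun f g h => by
      have h1 := hb (f - g)
      rw [q_eq_iff.1 h, mul_zero, map_sub] at h1
      exact sub_eq_zero.1 (norm_le_zero_iff.1 h1)
    let r : FNFA E → FAFA E := Function.surjInv q_surjective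
    have hr : ∀ a, q E (r a) = a := Function.surjInv_eq q_surjective
    let ψ : FNFA E →ₗ[ℝ] A :=
      { toFun := fun a => φ (r a)
        map_add' := fun a b => by
          rw [← map_add]
          exact hker _ _ (by rw [map_add, hr, hr, hr])
        map_smul' := fun c a => by
          rw [RingHom.id_apply, ← map_smul]
          exact hker _ _ (by rw [map_smul, hr, hr]) }
    have hψq : ∀ f, ψ (q E f) = φ f := fun f => hker _ _ (hr _)
    have hψ : IsLatticeAlgHom ψ :=
      { map_mul := fun a b => by
          rw [← hr a, ← hr b, ← q_mul, hψq, hψq, hψq, hφ.map_mul]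
        map_sup := fun a b => by
          rw [← hr a, ← hr b, ← q_sup, hψq, hψq, hψq, hφ.map_sup]
        map_inf := fun a b => by
          rw [← hr a, ← hr b, ← q_inf, hψq, hψq, hψq, hφ.map_inf] }
    have hψη : ∀ x, ψ (η E x) = T x := fun x => (hψq _).trans (FAFA.lift_δ _ x)
    have hψb : ∀ a, ‖ψ a‖ ≤ ‖T‖ * ‖a‖ := fun a => by
      rw [← hr a, hψq, norm_q]
      exact hb _
    refine ⟨ψ.mkContinuous ‖T‖ hψb, hψ, hψη, le_antisymm
      (ψ.mkContinuous_norm_le (norm_nonneg T) hψb)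
      (T.opNorm_le_bound (norm_nonneg _) fun x => ?_), fun S hS h => ?_⟩
    · rw [← norm_η x, ← hψη]
      exact (ψ.mkContinuous ‖T‖ hψb).le_opNorm _
    · exact hom_ext hS hψ fun x => (h x).trans (hψη x).symm

end FNFA

/-! ### The universal property of `FBFA E` -/

namespace FBFA
variable {E : Type*} [NormedAddCommGroup E] [NormedSpace ℝ E]

theorem isLatticeAlgHom_ι : IsLatticeAlgHom (ι E).toLinearMap := ⟨ι_mul, ι_sup, ι_inf⟩

theorem norm_η (x : E) : ‖η E x‖ = ‖x‖ := ((ι E).norm_map _).trans (FNFA.norm_η x)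

/-- No boundedness is assumed: lattice homomorphisms are monotone, hence continuous on the complete
space `FBFA E`, and agreement on the dense image of `FNFA E` suffices. -/
theorem hom_ext {A : Type*} [NonUnitalNormedRing A] [NormedSpace ℝ A] [Lattice A] [IsFAlgebra A]
    [HasSolidNorm A] {φ ψ : FBFA E →ₗ[ℝ] A} (hφ : IsLatticeAlgHom φ) (hψ : IsLatticeAlgHom ψ)
    (h : ∀ x, φ (η E x) = ψ (η E x)) : φ = ψ := by
  have h1 := FNFA.hom_ext (hφ.comp isLatticeAlgHom_ι) (hψ.comp isLatticeAlgHom_ι) h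
  refine DFunLike.coe_injective (isDenseInducing_ι.dense.equalizer
    (φ.continuous_of_monotone hφ.monotone) (ψ.continuous_of_monotone hψ.monotone) ?_)
  exact funext fun a => LinearMap.congr_fun h1 a

theorem isFreeBanachFAlgebra (E : Type u) [NormedAddCommGroup E] [NormedSpace ℝ E] :
    IsFreeBanachFAlgebra.{u, u, w} E (FBFA E) (η E) where
  isometry := norm_η
  lift A _ _ _ _ _ _ T hT := by
    obtain ⟨φ, hφ, hφη, hφn, -⟩ := (FNFA.isFreeNormedFAlgebra.{u, w} E).lift A T hT
    have hd : DenseRange (ι E).toLinearMap := isDenseInducing_ι.dense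
    have hb : ∀ a, ‖(φ : FNFA E →ₗ[ℝ] A) a‖ ≤ ‖T‖ * ‖(ι E).toLinearMap a‖ := fun a => by
      rw [LinearIsometry.coe_toLinearMap, (ι E).norm_map, ← hφn]
      exact φ.le_opNorm a
    let ψ : FBFA E →L[ℝ] A := (φ : FNFA E →ₗ[ℝ] A).extendOfNorm (ι E).toLinearMap
    have hψι : ∀ a, ψ (ι E a) = φ a := fun a => LinearMap.extendOfNorm_eq hd ⟨_, hb⟩ a
    have hψ : IsLatticeAlgHom (ψ : FBFA E →ₗ[ℝ] A) :=
      -- Each identity is a closed condition, since products and lattice operations are continuous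
      -- on both sides, so it need only be checked on the image of `FNFA E`.
      { map_mul := fun x y => ind₂ (p := fun x y => ψ (x * y) = ψ x * ψ y) x y
          (isClosed_eq (by fun_prop) (by fun_prop)) fun a b => by
            rw [← ι_mul, hψι, hψι, hψι]; exact hφ.map_mul a b
        map_sup := fun x y => ind₂ (p := fun x y => ψ (x ⊔ y) = ψ x ⊔ ψ y) x y
          (isClosed_eq (by fun_prop) (by fun_prop)) fun a b => by
            rw [← ι_sup, hψι, hψι, hψι]; exact hφ.map_sup a b
        map_inf := fun x y => ind₂ (p := fun x y => ψ (x ⊓ y) = ψ x ⊓ ψ y) x y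
          (isClosed_eq (by fun_prop) (by fun_prop)) fun a b => by
            rw [← ι_inf, hψι, hψι, hψι]; exact hφ.map_inf a b }
    have hψη : ∀ x, ψ (η E x) = T x := fun x => (hψι _).trans (hφη x)
    refine ⟨ψ, hψ, hψη, le_antisymm
      (LinearMap.opNorm_extendOfNorm_le hd (norm_nonneg T) hb)
      (T.opNorm_le_bound (norm_nonneg _) fun x => ?_), fun S hS h => ?_⟩
    · rw [← norm_η x, ← hψη]
      exact ψ.le_opNorm _
    · exact hom_ext hS hψ fun x => (h x).trans (hψη x).symm

end FBFA

end

theorem mainTheorem5 (E : Type u) [NormedAddCommGroup E] [NormedSpace ℝ E] :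
    (FAFA.IsAdmissible (FAFA.ρ E) ∧
        ∀ ν : Seminorm ℝ (FAFA E), FAFA.IsAdmissible ν → ∀ f : FAFA E, ν f ≤ FAFA.ρ E f) ∧
      (IsLatticeAlgHom (FNFA.q E) ∧ Function.Surjective (FNFA.q E) ∧
        (∀ f : FAFA E, ‖FNFA.q E f‖ = FAFA.ρ E f) ∧
        ∀ x : E, FNFA.η E x = FNFA.q E (FAFA.δ x)) ∧
      IsFreeNormedFAlgebra.{u, u, w} E (FNFA E) (FNFA.η E) ∧
      (IsLatticeAlgHom (FBFA.ι E).toLinearMap ∧ DenseRange (FBFA.ι E) ∧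
        ∀ x : E, FBFA.η E x = FBFA.ι E (FNFA.η E x)) ∧
      (CompleteSpace E → IsFreeBanachFAlgebra.{u, u, w} E (FBFA E) (FBFA.η E)) :=
  ⟨⟨FAFA.isAdmissible_ρ, fun _ hν f => FAFA.le_iSup_admissible hν f⟩,
    ⟨FNFA.isLatticeAlgHom_q, FNFA.q_surjective, FNFA.norm_q, fun _ => rfl⟩,
    FNFA.isFreeNormedFAlgebra E,
    ⟨FBFA.isLatticeAlgHom_ι, FBFA.isDenseInducing_ι.dense, fun _ => rfl⟩,
    fun _ => FBFA.isFreeBanachFAlgebra E⟩
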